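/- Let $\theta>0$ and let $n_1,n_2,\ldots$ be integers with $n_i\ge 1$; put $N_t=n_1+\cdots+n_t$ ($N_0=0$), and let $M(n_1,\ldots,n_t)$ be the multiset with $n_i$ copies of $i$ for $1\le i\le t$. By a theorem of Knuth every permutation $\pi$ of $M(n_1,\ldots,n_t)$ is represented uniquely as an intercalation product of cycles $(x_{1,1}\ldots x_{1,m_1}\,y_1)\perp\cdots\perp(x_{r,1}\ldots x_{r,m_r}\,y_r)$ with $y_1\le\cdots\le y_r$ and $y_i<x_{i,j}$ for all $i,j$; $|\pi|=r$ is the number of cycles of $\pi$. The multiset Chinese restaurant process is the Markov chain $(\tilde\Pi_t)_{t\ge0}$, with $\tilde\Pi_t$ a permutation of $M(n_1,\ldots,n_t)$ in this representation and $\tilde\Pi_0=\emptyset$, which moves from time $t-1$ to time $t$ as follows: for some $0\le k\le n_t$, $k$ of the copies of $t$ form $k$ new singleton cycles $(t)$, and the other $n_t-k$ copies are inserted immediately to the left of entries of the cycles of $\tilde\Pi_{t-1}$ (any number of copies at each entry); each such way has probability $\theta^{k}/F_t(\theta)$, where $$F_t(\theta)=\sum_{k=0}^{n_t}\binom{N_{t-1}-1+n_t-k}{n_t-k}\theta^{k},\qquad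 \binom{-1}{0}=1 .$$ Let $K_t=|\tilde\Pi_t|$. If $\theta=1$ and $n_i=n\ge 1$ for all $i\ge1$, then ${\mathbb E}(K_t)/\log t\to1$ and ${\rm Var}(K_t)/\log t\to 1$ as $t\to\infty$. For every $\theta>0$, if the sequence $n_i\geq 1$ is bounded, then there are constants $C_1,C_2>0$ with $C_1\log t\le {\mathbb E}(K_t)\le C_2\log t$ for all $t\ge2$, and likewise (with possibly other constants) for ${\rm Var}(K_t)$; moreover $K_t/{\mathbb E}(K_t)\to1$ almost surely, and $(K_t-{\mathbb E}(K_t))/\sqrt{{\rm Var}(K_t)}$ converges in distribution to ${\rm N}(0,1)$ as $t\to\infty$. -/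

import Mathlib

open MeasureTheory ProbabilityTheory Filter Topology

namespace MultisetCRP

/-- `N_t = n_1 + ⋯ + n_t`. (The value `n 0` is never used.) -/
def totalSize (n : ℕ → ℕ) (t : ℕ) : ℕ := ∑ i ∈ Finset.Icc 1 t, n i

/-- The multiset `M(n_1, …, n_t)`, with `n_i` copies of `i` for `1 ≤ i ≤ t`. -/
def baseMultiset (n : ℕ → ℕ) (t : ℕ) : Multiset ℕ :=
  ∑ i ∈ Finset.Icc 1 t, Multiset.replicate (n i) i

/-- A cycle `(x_1 … x_m y)` of a multiset permutation, with its last entry `y` kept apart. -/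
@[ext]
structure MCycle where
  xs : List ℕ
  y : ℕ

/-- The word `x_1 … x_m y` of a cycle. -/
def MCycle.word (c : MCycle) : List ℕ := c.xs ++ [c.y]

/-- A permutation of `M(n_1, …, n_t)`, represented by its unique factorisation as an
intercalation product of cycles `(x_{i,1} … x_{i,m_i} y_i)` with `y_1 ≤ y_2 ≤ ⋯`
and `y_i < x_{i,j}`. -/
@[ext]
structure MultisetPerm (n : ℕ → ℕ) (t : ℕ) where
  /-- The factors, in order. -/
  cycles : List MCycle
  content : (cycles.map fun c => (c.word : Multiset ℕ)).sum = baseMultiset n t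
  sorted : cycles.Pairwise fun c d => c.y ≤ d.y
  last_lt : ∀ c ∈ cycles, ∀ x ∈ c.xs, c.y < x

instance (n : ℕ → ℕ) (t : ℕ) : MeasurableSpace (MultisetPerm n t) := ⊤

/-- `|π|`, the number of cycles of the multiset permutation `π`. -/
def MultisetPerm.numCycles {n : ℕ → ℕ} {t : ℕ} (π : MultisetPerm n t) : ℕ := π.cycles.length

/-- The places of a list of cycles: `⟨i, j⟩` is the place of the `j`-th entry of the word of the
`i`-th cycle (so `j = (xs).length` is the place of `y`). -/
abbrev Place (l : List MCycle) : Type := (i : Fin l.length) × Fin ((l.get i).xs.length + 1)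

/-- Insert, for each `j`, `m j` copies of `u` immediately to the left of the `j`-th entry of the
cycle `c`. -/
def MCycle.insertLeft (u : ℕ) (c : MCycle) (m : Fin (c.xs.length + 1) → ℕ) : MCycle where
  xs := (List.ofFn fun j : Fin c.xs.length =>
      List.replicate (m j.castSucc) u ++ [c.xs.get j]).flatten ++
    List.replicate (m (Fin.last _)) u
  y := c.y

/-- Insert copies of `u` immediately to the left of the entries of `l`, at each place as many
copies as the multiset `s` of places says, and append `k` new singleton cycles `(u)`. -/
def insertCopies (u : ℕ) (l : List MCycle) (k : ℕ) (s : Multiset (Place l)) : List MCycle :=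
  (List.ofFn fun i : Fin l.length =>
      (l.get i).insertLeft u fun j => s.count (⟨i, j⟩ : Place l)) ++
    List.replicate k ⟨[], u⟩

theorem coe_word_insertLeft (u : ℕ) (c : MCycle) (m : Fin (c.xs.length + 1) → ℕ) :
    ((c.insertLeft u m).word : Multiset ℕ) =
      (c.word : Multiset ℕ) + Multiset.replicate (∑ j, m j) u := by
  have key : ∀ (l : List ℕ) (f : Fin l.length → ℕ),
      (((List.ofFn fun j : Fin l.length => List.replicate (f j) u ++ [l.get j]).flatten :
        List ℕ) : Multiset ℕ) = (l : Multiset ℕ) + Multiset.replicate (∑ j, f j) u := by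
    intro l
    induction l with
    | nil => intro f; simp
    | cons a l ih =>
      intro f
      have h := ih fun j => f j.succ
      simp only [List.length_cons, List.ofFn_succ, List.flatten_cons, Fin.sum_univ_succ,
        List.get_cons_zero]
      rw [← Multiset.coe_add]
      refine (congrArg _ h).trans ?_
      rw [← Multiset.coe_add, Multiset.coe_replicate, Multiset.replicate_add,
        show ((a :: l : List ℕ) : Multiset ℕ) = ([a] : List ℕ) + (l : Multiset ℕ) from rfl]
      abel
  have h := key c.xs fun j => m j.castSucc
  simp only [MCycle.word, MCycle.insertLeft, ← Multiset.coe_add]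
  rw [h, Fin.sum_univ_castSucc, Multiset.replicate_add, Multiset.coe_replicate]
  abel

theorem mem_xs_insertLeft {u : ℕ} {c : MCycle} {m : Fin (c.xs.length + 1) → ℕ} {x : ℕ}
    (h : x ∈ (c.insertLeft u m).xs) : x ∈ c.xs ∨ x = u := by
  simp only [MCycle.insertLeft, List.mem_append, List.mem_flatten, List.mem_ofFn,
    List.mem_replicate] at h
  rcases h with ⟨w, ⟨j, rfl⟩, hx⟩ | ⟨_, rfl⟩
  · simp only [List.mem_append, List.mem_replicate, List.mem_singleton] at hx
    rcases hx with ⟨_, rfl⟩ | rfl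
    · exact Or.inr rfl
    · exact Or.inl (List.get_mem _ _)
  · exact Or.inr rfl

theorem content_insertCopies (u : ℕ) (l : List MCycle) (k : ℕ) (s : Multiset (Place l)) :
    ((insertCopies u l k s).map fun c => (c.word : Multiset ℕ)).sum =
      (l.map fun c => (c.word : Multiset ℕ)).sum + Multiset.replicate (s.card + k) u := by
  have h1 : (l.map fun c => (c.word : Multiset ℕ)).sum =
      ∑ i : Fin l.length, ((l.get i).word : Multiset ℕ) := by
    rw [← List.sum_ofFn]
    congr 1
    conv_lhs => rw [← List.ofFn_get l, List.map_ofFn]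
    rfl
  have h2 : (∑ i : Fin l.length, ∑ j, s.count (⟨i, j⟩ : Place l)) = s.card := by
    rw [← Fintype.sum_sigma' (fun (i : Fin l.length) j => s.count (⟨i, j⟩ : Place l))]
    exact Multiset.sum_count_eq_card fun a _ => Finset.mem_univ a
  have h3 : ∀ (f : Fin l.length → ℕ), ∑ i, Multiset.replicate (f i) u =
      Multiset.replicate (∑ i, f i) u := fun f =>
    (map_sum (Multiset.replicateAddMonoidHom u) f Finset.univ).symm
  have h4 : (List.map (fun c : MCycle => (c.word : Multiset ℕ))
      (List.replicate k ⟨[], u⟩)).sum = Multiset.replicate k u := by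
    rw [List.map_replicate, List.sum_replicate]
    simp [MCycle.word, Multiset.nsmul_singleton]
  rw [insertCopies, List.map_append, List.sum_append, h4, List.map_ofFn, List.sum_ofFn, h1]
  simp only [Function.comp_apply, coe_word_insertLeft, Finset.sum_add_distrib]
  rw [h3, h2, Multiset.replicate_add, add_assoc]

theorem MultisetPerm.mem_le {n : ℕ → ℕ} {t : ℕ} (π : MultisetPerm n t) {c : MCycle}
    (hc : c ∈ π.cycles) : c.y ≤ t := by
  have h1 : c.y ∈ (π.cycles.map fun c => (c.word : Multiset ℕ)).sum := by
    have h := List.single_le_sum (l := π.cycles.map fun c => (c.word : Multiset ℕ))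
      (fun _ _ => Multiset.zero_le _) _ (List.mem_map_of_mem hc)
    exact Multiset.mem_of_le h (by simp [MCycle.word])
  rw [π.content, baseMultiset, Multiset.mem_sum] at h1
  obtain ⟨i, hi, h⟩ := h1
  rw [Multiset.eq_of_mem_replicate h]
  exact (Finset.mem_Icc.1 hi).2

/-- The extension of a permutation of `M(n_1, …, n_t)` to one of `M(n_1, …, n_{t+1})` in which
`k` of the `n_{t+1}` copies of `t + 1` form new singleton cycles and the others are inserted to
the left of existing entries, as prescribed by the multiset `s` of places. -/
def MultisetPerm.extend {n : ℕ → ℕ} {t : ℕ} (π : MultisetPerm n t) (k : Fin (n (t + 1) + 1))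
    (s : Sym (Place π.cycles) (n (t + 1) - k)) : MultisetPerm n (t + 1) where
  cycles := insertCopies (t + 1) π.cycles k s
  content := by
    rw [content_insertCopies, π.content, baseMultiset, baseMultiset,
      Finset.sum_Icc_succ_top (by omega)]
    congr 2
    have h : Multiset.card (s : Multiset (Place π.cycles)) = n (t + 1) - k := s.2
    rw [h]
    omega
  sorted := by
    rw [insertCopies, List.pairwise_append]
    refine ⟨?_, ?_, ?_⟩
    · rw [List.pairwise_ofFn]
      intro i j hij
      exact List.pairwise_iff_get.1 π.sorted i j hij
    · exact List.pairwise_replicate.2 (Or.inr le_rfl)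
    · intro a ha b hb
      obtain ⟨i, rfl⟩ := List.mem_ofFn.1 ha
      rw [(List.mem_replicate.1 hb).2]
      exact (π.mem_le (c := π.cycles.get i) (List.get_mem _ i)).trans (Nat.le_succ t)
  last_lt := by
    intro c hc x hx
    rcases List.mem_append.1 hc with hc | hc
    · obtain ⟨i, rfl⟩ := List.mem_ofFn.1 hc
      rcases mem_xs_insertLeft hx with h | rfl
      · exact π.last_lt _ (List.get_mem _ i) _ h
      · exact Nat.lt_succ_of_le (π.mem_le (c := π.cycles.get i) (List.get_mem _ i))
    · rw [(List.mem_replicate.1 hc).2] at hx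
      simp at hx

/-- `F_t(θ) = ∑_{k=0}^{n_t} binom(N_{t-1} - 1 + n_t - k, n_t - k) θ^k`, here at `t + 1` in place
of `t`; `Nat.multichoose a b` is `binom(a + b - 1, b)`, with value `1` at `a = b = 0`. -/
def normalizer (θ : ℝ) (n : ℕ → ℕ) (t : ℕ) : ℝ :=
  ∑ k ∈ Finset.range (n (t + 1) + 1),
    (Nat.multichoose (totalSize n t) (n (t + 1) - k) : ℝ) * θ ^ k

open Classical in
/-- The transition probability of the multiset Chinese restaurant process from `π` at time `t`
to `π'` at time `t + 1`: each way of extending `π` that creates `k` new cycles is taken with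
probability `θ ^ k / F_{t+1}(θ)`. -/
noncomputable def transitionProb (θ : ℝ) {n : ℕ → ℕ} {t : ℕ} (π : MultisetPerm n t)
    (π' : MultisetPerm n (t + 1)) : ℝ :=
  ∑ k : Fin (n (t + 1) + 1), ∑ s : Sym (Place π.cycles) (n (t + 1) - k),
    if π.extend k s = π' then θ ^ (k : ℕ) / normalizer θ n t else 0

/-- `X` is a multiset Chinese restaurant process with parameter `θ` and multiplicities `n_i`
under `P`: a Markov chain, started at the empty permutation (the only permutation of the empty
multiset) at time `0`, with the above transition probabilities. -/
structure IsCRP {Ω : Type*} [MeasurableSpace Ω] (P : Measure Ω) (θ : ℝ) (n : ℕ → ℕ)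
    (X : (t : ℕ) → Ω → MultisetPerm n t) : Prop where
  measurable : ∀ t, Measurable (X t)
  markov : ∀ (t : ℕ) (π : (s : ℕ) → MultisetPerm n s),
    P.real {ω | ∀ s ≤ t + 1, X s ω = π s} =
      P.real {ω | ∀ s ≤ t, X s ω = π s} * transitionProb θ (π t) (π (t + 1))

/-- `a_t ≍ b_t`. It is used with `b_t = log t`, which vanishes at `t = 1` (and `log 0` is not
defined), so the bounds are for `t ≥ 2`. -/
def SameOrder (a b : ℕ → ℝ) : Prop :=
  ∃ C₁ > 0, ∃ C₂ > 0, ∀ t ≥ 2, C₁ * b t ≤ a t ∧ a t ≤ C₂ * b t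

end MultisetCRP

namespace MultisetCRP

/-! Write `D t = K (t+1) - K t`. A permutation at time `t` has exactly `N_t` entries whatever its
cycle structure, so the number of ways to make `k` new cycles depends on the past only through
`N_t`. Hence `D t` is independent of the present state, with explicit law `p_k ∝ multichoose N_t
(m-k) θ^k`, where `m = n_{t+1}`. One-step independence suffices: means, variances and centred
characteristic functions all satisfy one-step recursions.

The law is controlled by the ratio `p_{k+1}/p_k = θ(j+1)/(N+j)`, `j = m-k-1`. For `m ≤ C` and `t ≤
N_t ≤ Ct` it gives `E D ≍ 1/t`, `E D(D-1) = O(1/t²)` and `Var D ≥ p_0 p_1 ≥ c/t`; summing yields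
order `log t`. If `θ = 1` and `n_i = m`, the ratio at `k = 0` is `m/(tm+m-1)`, so `t E D → 1` and `t
Var D → 1`, which gives the sharp logarithmic asymptotics.

The limit theorems use only increments in `[0, C]` and divergence of the mean or of the variance.
For almost sure convergence, `Var K ≤ C E K` makes the squared relative deviations summable along
times when `E K` first reaches `k²`; monotonicity fills the gaps. For the central limit theorem,
replacing increments one at a time by Gaussian ones costs `O(|s|³ C Var D)` in the characteristic
function at `s`, hence `O(1/σ)` in total at `s = x/σ`, where `σ² = Var K`. -/

/-- The probability that, of `m` copies inserted into a permutation with `N` entries, exactly `k`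
form new singleton cycles. -/
noncomputable def newCycleProb (θ : ℝ) (N m k : ℕ) : ℝ :=
  (Nat.multichoose N (m - k) : ℝ) * θ ^ k /
    ∑ j ∈ Finset.range (m + 1), (Nat.multichoose N (m - j) : ℝ) * θ ^ j

/-! ### Estimates for the law of the number of new cycles in one step. -/

section newCycleProb

variable {θ : ℝ} {N m : ℕ}

theorem sum_multichoose_mul_pow_pos (hθ : 0 < θ) (N m : ℕ) :
    0 < ∑ j ∈ Finset.range (m + 1), (Nat.multichoose N (m - j) : ℝ) * θ ^ j := by
  rw [Finset.sum_range_succ]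
  have h : 0 ≤ ∑ j ∈ Finset.range m, (Nat.multichoose N (m - j) : ℝ) * θ ^ j :=
    Finset.sum_nonneg fun _ _ => by positivity
  have h' : 0 < (Nat.multichoose N (m - m) : ℝ) * θ ^ m := by
    rw [Nat.sub_self, Nat.multichoose_zero_right]; positivity
  linarith

theorem newCycleProb_nonneg (hθ : 0 < θ) (N m k : ℕ) : 0 ≤ newCycleProb θ N m k :=
  div_nonneg (by positivity) (sum_multichoose_mul_pow_pos hθ N m).le

theorem sum_newCycleProb (hθ : 0 < θ) (N m : ℕ) :
    ∑ k ∈ Finset.range (m + 1), newCycleProb θ N m k = 1 := by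
  simp only [newCycleProb]
  rw [← Finset.sum_div, div_self (sum_multichoose_mul_pow_pos hθ N m).ne']

theorem newCycleProb_zero_le_one (hθ : 0 < θ) (N m : ℕ) : newCycleProb θ N m 0 ≤ 1 := by
  rw [← sum_newCycleProb hθ N m]
  exact Finset.single_le_sum (f := newCycleProb θ N m) (fun k _ => newCycleProb_nonneg hθ N m k)
    (Finset.mem_range.2 (Nat.succ_pos m))

/-- The normaliser cancels in the ratio of consecutive weights, leaving `(j+1) multichoose N (j+1) =
(N+j) multichoose N j`. Every later estimate of the law comes from this identity. -/
theorem newCycleProb_succ_mul (θ : ℝ) (hN : 1 ≤ N) (k j : ℕ) (hm : m = k + 1 + j) :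
    newCycleProb θ N m (k + 1) * (N + j) = newCycleProb θ N m k * (θ * (j + 1)) := by
  obtain ⟨M, rfl⟩ : ∃ M, N = M + 1 := ⟨N - 1, by omega⟩
  have h : ((M + 1).multichoose (j + 1) : ℝ) * (j + 1) =
      (M + 1).multichoose j * ((M + 1 : ℕ) + j) := by
    rw [Nat.multichoose_eq, Nat.multichoose_eq]
    have := Nat.add_one_mul_choose_eq (M + j) j
    rw [show M + 1 + (j + 1) - 1 = M + j + 1 by omega, show M + 1 + j - 1 = M + j by omega]
    have h2 : ((M + j + 1 : ℕ) : ℝ) * ((M + j).choose j : ℕ) =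
      ((M + j + 1).choose (j + 1) : ℕ) * ((j + 1 : ℕ) : ℝ) := by exact_mod_cast this
    push_cast at h2 ⊢
    linarith
  simp only [newCycleProb]
  rw [show m - (k + 1) = j by omega, show m - k = j + 1 by omega, div_mul_eq_mul_div,
    div_mul_eq_mul_div]
  congr 1
  rw [pow_succ]
  linear_combination (-θ ^ k * θ) * h

theorem newCycleProb_succ_le (hθ : 0 < θ) (hN : 1 ≤ N) {C : ℕ} (hC : m ≤ C) {k : ℕ} (hk : k < m) :
    newCycleProb θ N m (k + 1) ≤ newCycleProb θ N m k * (θ * C / N) := by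
  obtain ⟨j, hj⟩ : ∃ j, m = k + 1 + j := ⟨m - (k + 1), by omega⟩
  have h := newCycleProb_succ_mul θ hN k j hj
  have hN' : (0 : ℝ) < N := by exact_mod_cast hN
  rw [mul_div_assoc', le_div_iff₀ hN']
  have hjC : (j : ℝ) + 1 ≤ C := by exact_mod_cast (by omega : j + 1 ≤ C)
  calc _ ≤ newCycleProb θ N m (k + 1) * (N + j) := by
        gcongr
        · exact newCycleProb_nonneg hθ _ _ _
        · simp
    _ = _ := h
    _ ≤ _ := by
        gcongr
        exact newCycleProb_nonneg hθ _ _ _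

/-- Each new cycle costs a factor `θC/N`: bound `k` by `C` and `p_k` by `p_{k-1} θC/N`, then use
that the shifted probabilities sum to at most 1. -/
theorem sum_mul_newCycleProb_le (hθ : 0 < θ) (hN : 1 ≤ N) {C : ℕ} (hC : m ≤ C) :
    ∑ k ∈ Finset.range (m + 1), newCycleProb θ N m k * k ≤ C * (θ * C / N) := by
  rw [Finset.sum_range_succ']
  simp only [Nat.cast_zero, mul_zero, add_zero]
  have hp := newCycleProb_nonneg hθ N m
  calc _ ≤ ∑ k ∈ Finset.range m, newCycleProb θ N m k * (C * (θ * C / N)) := by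
        refine Finset.sum_le_sum fun k hk => ?_
        rw [Finset.mem_range] at hk
        have hkC : ((k + 1 : ℕ) : ℝ) ≤ C := by exact_mod_cast (by omega : k + 1 ≤ C)
        calc _ ≤ newCycleProb θ N m k * (θ * C / N) * C :=
              mul_le_mul (newCycleProb_succ_le hθ hN hC hk) hkC (by positivity)
                (mul_nonneg (hp k) (by positivity))
          _ = _ := by ring
    _ = (∑ k ∈ Finset.range m, newCycleProb θ N m k) * (C * (θ * C / N)) := by
        rw [Finset.sum_mul]
    _ ≤ 1 * (C * (θ * C / N)) := by
        gcongr
        rw [← sum_newCycleProb hθ N m, Finset.sum_range_succ]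
        linarith [hp m]
    _ = _ := one_mul _

/-- Only `k ≥ 2` contributes, so the ratio bound applies twice. The order `N⁻²` makes several new
cycles in one step negligible. -/
theorem sum_mul_sub_one_newCycleProb_le (hθ : 0 < θ) (hN : 1 ≤ N) {C : ℕ} (hC : m ≤ C) :
    ∑ k ∈ Finset.range (m + 1), newCycleProb θ N m k * (k * (k - 1)) ≤
      C ^ 2 * (θ * C / N) ^ 2 := by
  obtain _ | m' := m
  · simp; positivity
  have hp := newCycleProb_nonneg hθ N (m' + 1)
  rw [Finset.sum_range_succ', Finset.sum_range_succ']
  simp only [Nat.cast_zero, zero_mul, mul_zero, add_zero, zero_add, Nat.cast_one, sub_self]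
  calc _ ≤ ∑ k ∈ Finset.range m', newCycleProb θ N (m' + 1) k * (C ^ 2 * (θ * C / N) ^ 2) := by
        refine Finset.sum_le_sum fun k hk => ?_
        rw [Finset.mem_range] at hk
        have hkC : ((k + 1 + 1 : ℕ) : ℝ) ≤ C := by exact_mod_cast (by omega : k + 1 + 1 ≤ C)
        have h1 := newCycleProb_succ_le hθ hN hC (by omega : k < m' + 1)
        have h2 := newCycleProb_succ_le hθ hN hC (by omega : k + 1 < m' + 1)
        have h3 : newCycleProb θ N (m' + 1) (k + 1 + 1) ≤
            newCycleProb θ N (m' + 1) k * (θ * C / N) * (θ * C / N) :=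
          h2.trans (by gcongr)
        push_cast at hkC ⊢
        calc _ ≤ newCycleProb θ N (m' + 1) k * (θ * C / N) * (θ * C / N) * (C * C) := by
              refine mul_le_mul h3 ?_ ?_ ?_
              · exact mul_le_mul hkC (by linarith) (by ring_nf; positivity) (by positivity)
              · ring_nf; positivity
              · have := hp k; positivity
          _ = _ := by ring
    _ = (∑ k ∈ Finset.range m', newCycleProb θ N (m' + 1) k) * (C ^ 2 * (θ * C / N) ^ 2) := by
        rw [Finset.sum_mul]
    _ ≤ 1 * (C ^ 2 * (θ * C / N) ^ 2) := by
        gcongr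
        rw [← sum_newCycleProb hθ N (m' + 1), Finset.sum_range_succ, Finset.sum_range_succ]
        linarith [hp m', hp (m' + 1)]
    _ = _ := one_mul _

/-- Iterating the ratio bound with `N ≥ 1` gives `p_k ≤ p_0 (θC)^k`; since the `p_k` sum to 1, `p_0`
is bounded below uniformly in `N`. -/
theorem newCycleProb_zero_ge (hθ : 0 < θ) (hN : 1 ≤ N) {C : ℕ} (hC : m ≤ C) :
    (∑ k ∈ Finset.range (C + 1), (θ * C) ^ k)⁻¹ ≤ newCycleProb θ N m 0 := by
  have hp := newCycleProb_nonneg hθ N m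
  have hN' : (1 : ℝ) ≤ N := by exact_mod_cast hN
  have hk : ∀ k ≤ m, newCycleProb θ N m k ≤ newCycleProb θ N m 0 * (θ * C) ^ k := by
    intro k
    induction k with
    | zero => simp
    | succ k ih =>
      intro hk
      calc _ ≤ _ := newCycleProb_succ_le hθ hN hC (by omega)
        _ ≤ newCycleProb θ N m k * (θ * C) := by
          gcongr
          · exact hp k
          · exact div_le_self (by positivity) hN'
        _ ≤ newCycleProb θ N m 0 * (θ * C) ^ k * (θ * C) := by
          gcongr
          exact ih (by omega)
        _ = _ := by ring
  have hS : 0 < ∑ k ∈ Finset.range (C + 1), (θ * C) ^ k := by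
    rw [Finset.sum_range_succ']
    have : 0 ≤ ∑ k ∈ Finset.range C, (θ * (C : ℝ)) ^ (k + 1) :=
      Finset.sum_nonneg fun _ _ => by positivity
    simp only [pow_zero]
    linarith
  rw [inv_le_iff_one_le_mul₀ hS, ← sum_newCycleProb hθ N m]
  calc _ ≤ ∑ k ∈ Finset.range (m + 1), newCycleProb θ N m 0 * (θ * C) ^ k :=
        Finset.sum_le_sum fun k h => hk k (by rw [Finset.mem_range] at h; omega)
    _ = newCycleProb θ N m 0 * ∑ k ∈ Finset.range (m + 1), (θ * C) ^ k := by rw [Finset.mul_sum]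
    _ ≤ _ := by
        gcongr
        · exact hp 0

theorem newCycleProb_one_ge (hθ : 0 < θ) (hN : 1 ≤ N) (hm : 1 ≤ m) {C : ℕ} (hC : m ≤ C) :
    newCycleProb θ N m 0 * (θ / (N + C)) ≤ newCycleProb θ N m 1 := by
  obtain ⟨j, hj⟩ : ∃ j, m = 0 + 1 + j := ⟨m - 1, by omega⟩
  have h := newCycleProb_succ_mul θ hN 0 j hj
  have hN' : (0 : ℝ) < N := by exact_mod_cast hN
  have hp := newCycleProb_nonneg hθ N m
  have hjC : (j : ℝ) ≤ C := by exact_mod_cast (by omega : j ≤ C)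
  rw [mul_div_assoc', div_le_iff₀ (by positivity)]
  calc _ ≤ newCycleProb θ N m 0 * (θ * (j + 1)) := by
        gcongr
        · exact hp 0
        · nlinarith [(Nat.cast_nonneg j : (0 : ℝ) ≤ j)]
    _ = newCycleProb θ N m 1 * (N + j) := h.symm
    _ ≤ _ := by
        gcongr
        exact hp 1

/-- Keep only the terms 0 and 1. With `a = p_0`, `b = p_1`, one has `(a+b)(aμ² + b(1-μ)²) = ab + (aμ
- b(1-μ))²`, and `a + b ≤ 1`. Taking `μ` to be the mean bounds the variance below. -/
theorem le_sum_sq_sub_mul_newCycleProb (hθ : 0 < θ) (N : ℕ) (hm : 1 ≤ m) (μ : ℝ) :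
    newCycleProb θ N m 0 * newCycleProb θ N m 1 ≤
      ∑ k ∈ Finset.range (m + 1), newCycleProb θ N m k * (k - μ) ^ 2 := by
  obtain ⟨j, rfl⟩ : ∃ j, m = j + 1 := ⟨m - 1, by omega⟩
  have hp := newCycleProb_nonneg hθ N (j + 1)
  have hsum := sum_newCycleProb hθ N (j + 1)
  rw [Finset.sum_range_succ', Finset.sum_range_succ'] at hsum ⊢
  have h1 : 0 ≤ ∑ k ∈ Finset.range j, newCycleProb θ N (j + 1) (k + 1 + 1) :=
    Finset.sum_nonneg fun _ _ => hp _
  have h2 : 0 ≤ ∑ k ∈ Finset.range j,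
      newCycleProb θ N (j + 1) (k + 1 + 1) * (((k + 1 + 1 : ℕ) : ℝ) - μ) ^ 2 :=
    Finset.sum_nonneg fun _ _ => mul_nonneg (hp _) (sq_nonneg _)
  simp only [zero_add, Nat.cast_one, Nat.cast_zero] at hsum h2 ⊢
  have ha := hp 0
  have hb := hp 1
  set a := newCycleProb θ N (j + 1) 0
  set b := newCycleProb θ N (j + 1) 1
  have hx : 0 ≤ b * (1 - μ) ^ 2 + a * (0 - μ) ^ 2 := by positivity
  nlinarith [sq_nonneg (a * μ - b * (1 - μ))]

theorem newCycleProb_one_le_sum (hθ : 0 < θ) (N : ℕ) (hm : 1 ≤ m) :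
    newCycleProb θ N m 1 ≤ ∑ k ∈ Finset.range (m + 1), newCycleProb θ N m k * k := by
  have := Finset.single_le_sum (f := fun k : ℕ => newCycleProb θ N m k * k)
    (fun k _ => mul_nonneg (newCycleProb_nonneg hθ N m k) (Nat.cast_nonneg k))
    (Finset.mem_range.2 (by omega : 1 < m + 1))
  simpa using this

/-- Markov's inequality for the event of at least one new cycle. -/
theorem one_sub_sum_le_newCycleProb_zero (hθ : 0 < θ) (N m : ℕ) :
    1 - ∑ k ∈ Finset.range (m + 1), newCycleProb θ N m k * k ≤ newCycleProb θ N m 0 := by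
  rw [← sum_newCycleProb hθ N m, Finset.sum_range_succ', Finset.sum_range_succ']
  have : ∑ k ∈ Finset.range m, newCycleProb θ N m (k + 1) ≤
      ∑ k ∈ Finset.range m, newCycleProb θ N m (k + 1) * ((k + 1 : ℕ) : ℝ) :=
    Finset.sum_le_sum fun k _ => by
      refine le_mul_of_one_le_right (newCycleProb_nonneg hθ _ _ _) ?_
      exact_mod_cast Nat.succ_pos k
  simp only [Nat.cast_zero, mul_zero, add_zero]
  linarith

theorem sum_sub_newCycleProb_one_le (hθ : 0 < θ) (N : ℕ) (hm : 1 ≤ m) :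
    ∑ k ∈ Finset.range (m + 1), newCycleProb θ N m k * k - newCycleProb θ N m 1 ≤
      ∑ k ∈ Finset.range (m + 1), newCycleProb θ N m k * (k * (k - 1)) := by
  obtain ⟨j, rfl⟩ : ∃ j, m = j + 1 := ⟨m - 1, by omega⟩
  rw [Finset.sum_range_succ', Finset.sum_range_succ', Finset.sum_range_succ',
    Finset.sum_range_succ']
  have : ∑ k ∈ Finset.range j, newCycleProb θ N (j + 1) (k + 1 + 1) * ((k + 1 + 1 : ℕ) : ℝ) ≤
      ∑ k ∈ Finset.range j, newCycleProb θ N (j + 1) (k + 1 + 1) *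
        (((k + 1 + 1 : ℕ) : ℝ) * (((k + 1 + 1 : ℕ) : ℝ) - 1)) :=
    Finset.sum_le_sum fun k _ => by
      refine mul_le_mul_of_nonneg_left ?_ (newCycleProb_nonneg hθ _ _ _)
      refine le_mul_of_one_le_right (Nat.cast_nonneg _) ?_
      push_cast
      linarith [(Nat.cast_nonneg k : (0 : ℝ) ≤ k)]
  simp only [zero_add, Nat.cast_one, Nat.cast_zero, mul_one, sub_self, mul_zero, zero_mul]
  linarith

end newCycleProb

/-! ### Logarithmic asymptotics of sums. -/

/-- The terms differ from `1/i` by `o(1/i)`. As the harmonic series diverges, the partial sums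
differ by `o` of the harmonic sums, which are asymptotic to `log t`. -/
theorem tendsto_sum_range_div_log {u : ℕ → ℝ} (hu : Tendsto (fun i : ℕ => i * u i) atTop (𝓝 1)) :
    Tendsto (fun t : ℕ => (∑ i ∈ Finset.range t, u i) / Real.log t) atTop (𝓝 1) := by
  -- The term `i = 0` is `0⁻¹ = 0`, so the sum stops at the harmonic number of index `t - 1`.
  have hharm : ∀ t : ℕ, ∑ i ∈ Finset.range t, ((i : ℝ))⁻¹ = (harmonic (t - 1) : ℝ) := by
    intro t
    obtain _ | t := t
    · simp
    · rw [Finset.sum_range_succ', harmonic]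
      simp
  have hlog : Tendsto (fun t : ℕ => Real.log t) atTop atTop :=
    Real.tendsto_log_atTop.comp tendsto_natCast_atTop_atTop
  have hsub : Tendsto (fun t : ℕ => ∑ i ∈ Finset.range t, ((i : ℝ))⁻¹ - Real.log t) atTop
      (𝓝 Real.eulerMascheroniConstant) := by
    rw [← tendsto_add_atTop_iff_nat 1]
    simpa [hharm] using Real.tendsto_harmonic_sub_log_add_one
  have hH : Tendsto (fun t : ℕ => (∑ i ∈ Finset.range t, ((i : ℝ))⁻¹) / Real.log t) atTop
      (𝓝 1) := by
    have h := (hsub.div_atTop hlog).add_const 1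
    rw [zero_add] at h
    refine h.congr' ?_
    filter_upwards [hlog.eventually_gt_atTop 0] with t ht
    field_simp
    ring
  have hHtop : Tendsto (fun t : ℕ => ∑ i ∈ Finset.range t, ((i : ℝ))⁻¹) atTop atTop := by
    refine (hsub.add_atTop hlog).congr fun t => ?_
    ring
  have hlo : (fun i : ℕ => u i - (i : ℝ)⁻¹) =o[atTop] fun i : ℕ => (i : ℝ)⁻¹ := by
    rw [Asymptotics.isLittleO_iff_tendsto']
    · have h := hu.sub_const 1
      rw [sub_self] at h
      refine h.congr' ?_
      filter_upwards [eventually_gt_atTop 0] with i hi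
      have : (i : ℝ) ≠ 0 := by positivity
      field_simp
    · filter_upwards [eventually_gt_atTop 0] with i hi h0
      simp only [inv_eq_zero, Nat.cast_eq_zero] at h0
      omega
  have hsum := hlo.sum_range (fun i => by simp) hHtop
  have h := (hsum.tendsto_div_nhds_zero.mul hH).add hH
  rw [zero_mul, zero_add] at h
  refine h.congr' ?_
  filter_upwards [hlog.eventually_gt_atTop 0, hHtop.eventually_gt_atTop 0] with t ht ht'
  rw [div_mul_div_cancel₀ ht'.ne', ← add_div, Finset.sum_sub_distrib, sub_add_cancel]

/-! ### Gaussian approximation of the characteristic function of a bounded variable. -/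

section CharFun

variable {Ω : Type*} [MeasurableSpace Ω] {P : Measure Ω} [IsProbabilityMeasure P]

theorem norm_exp_mul_I_sub_le {x : ℝ} (hx : |x| ≤ 1) :
    ‖Complex.exp (x * Complex.I) - (1 + x * Complex.I - x ^ 2 / 2)‖ ≤ |x| ^ 3 := by
  have hn : ‖(x : ℂ) * Complex.I‖ = |x| := by simp
  have h := Complex.exp_bound (x := x * Complex.I) (by rw [hn]; exact hx) (n := 3) (by norm_num)
  rw [hn] at h
  have h2 : ∑ m ∈ Finset.range 3, ((x : ℂ) * Complex.I) ^ m / (m.factorial : ℂ) =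
      1 + x * Complex.I - x ^ 2 / 2 := by
    simp [Finset.sum_range_succ, mul_pow, Nat.factorial]
    ring
  rw [h2] at h
  refine h.trans ?_
  have : (0 : ℝ) ≤ |x| ^ 3 := by positivity
  simp [Nat.factorial]
  nlinarith

/-- Both terms are compared with `1 - s²v/2`, `v` the variance. The error is kept proportional to
`v`, so that errors over many increments add up to a multiple of the total variance. -/
theorem norm_charFun_map_sub_exp_le {Y : Ω → ℝ} (hY : Measurable Y) {C : ℝ}
    (hC : ∀ᵐ ω ∂P, |Y ω| ≤ C) (h0 : ∫ ω, Y ω ∂P = 0) {s : ℝ} (hs : |s| * C ≤ 1) :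
    ‖charFun (P.map Y) s - Complex.exp (-(s ^ 2 * variance Y P / 2 : ℝ))‖ ≤
      2 * |s| ^ 3 * C * variance Y P := by
  have hC0 : 0 ≤ C := by
    obtain ⟨ω, hω⟩ := hC.exists
    exact (abs_nonneg _).trans hω
  have hint : Integrable Y P := Integrable.of_bound hY.aestronglyMeasurable C (by simpa using hC)
  have hint2 : Integrable (fun ω => Y ω ^ 2) P :=
    Integrable.of_bound (hY.pow_const 2).aestronglyMeasurable (C ^ 2) (by
      filter_upwards [hC] with ω hω
      rw [Real.norm_eq_abs, abs_pow]
      gcongr)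
  have hv : variance Y P = ∫ ω, Y ω ^ 2 ∂P := by
    rw [variance_eq_integral hY.aemeasurable, h0]
    simp
  have hv0 : 0 ≤ variance Y P := variance_nonneg _ _
  have hvC : variance Y P ≤ C ^ 2 := by
    rw [hv]
    calc _ ≤ ∫ _, C ^ 2 ∂P := by
          refine integral_mono_ae hint2 (integrable_const _) ?_
          filter_upwards [hC] with ω hω
          exact sq_le_sq' (by linarith [abs_le.1 hω]) (abs_le.1 hω).2
      _ = _ := by simp
  set v := variance Y P with hvdef
  -- Second-order Taylor under the integral: the linear term vanishes by `h0`, and the remainder is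
  -- at most `|sY|³ ≤ |s|³ C Y²`.
  have h1 : ‖charFun (P.map Y) s - ((1 - s ^ 2 * v / 2 : ℝ) : ℂ)‖ ≤ |s| ^ 3 * C * v := by
    have hexp : Integrable (fun ω => Complex.exp ((s * Y ω : ℝ) * Complex.I)) P :=
      Integrable.of_bound (by fun_prop) 1 (by
        filter_upwards with ω
        rw [Complex.norm_exp_ofReal_mul_I])
    have hquad : Integrable (fun ω => (1 + (s * Y ω : ℝ) * Complex.I -
        ((s * Y ω : ℝ) : ℂ) ^ 2 / 2)) P := by
      have ha : Integrable (fun ω => (((s * Y ω : ℝ) : ℂ)) * Complex.I) P :=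
        (hint.const_mul s).ofReal.mul_const _
      have hb : Integrable (fun ω => ((s * Y ω : ℝ) : ℂ) ^ 2 / 2) P := by
        have := ((hint2.const_mul (s ^ 2)).ofReal (𝕜 := ℂ)).div_const 2
        refine this.congr (ae_of_all _ fun ω => ?_)
        simp [mul_pow]
      exact ((integrable_const _).add ha).sub hb
    have hI : ∫ ω, (1 + (s * Y ω : ℝ) * Complex.I - ((s * Y ω : ℝ) : ℂ) ^ 2 / 2) ∂P =
        ((1 - s ^ 2 * v / 2 : ℝ) : ℂ) := by
      have ha : Integrable (fun ω => (((s * Y ω : ℝ) : ℂ)) * Complex.I) P :=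
        (hint.const_mul s).ofReal.mul_const _
      have hb : Integrable (fun ω => (((s ^ 2 * Y ω ^ 2 : ℝ) : ℂ)) / 2) P :=
        ((hint2.const_mul (s ^ 2)).ofReal (𝕜 := ℂ)).div_const 2
      have e : (fun ω => (1 + (s * Y ω : ℝ) * Complex.I - ((s * Y ω : ℝ) : ℂ) ^ 2 / 2)) =
          fun ω => (1 + (((s * Y ω : ℝ) : ℂ)) * Complex.I - (((s ^ 2 * Y ω ^ 2 : ℝ) : ℂ)) / 2) := by
        ext ω; push_cast; ring
      rw [e, integral_sub (f := fun ω => 1 + ((s * Y ω : ℝ) : ℂ) * Complex.I)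
          ((integrable_const _).add ha) hb,
        integral_add (integrable_const _) ha, integral_mul_const, integral_div,
        integral_complex_ofReal, integral_complex_ofReal, integral_const_mul, integral_const_mul,
        h0, ← hv]
      simp
    have hcf : charFun (P.map Y) s = ∫ ω, Complex.exp ((s * Y ω : ℝ) * Complex.I) ∂P := by
      rw [charFun_apply_real, integral_map hY.aemeasurable (by fun_prop)]
      simp
    rw [hcf, ← hI, ← integral_sub hexp hquad]
    calc _ ≤ ∫ ω, |s| ^ 3 * C * Y ω ^ 2 ∂P := by
          refine norm_integral_le_of_norm_le (hint2.const_mul _) ?_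
          filter_upwards [hC] with ω hω
          have hle : |s * Y ω| ≤ 1 := by
            rw [abs_mul]
            exact (mul_le_mul_of_nonneg_left hω (abs_nonneg s)).trans hs
          refine (norm_exp_mul_I_sub_le hle).trans ?_
          rw [abs_mul, mul_pow, mul_assoc]
          refine mul_le_mul_of_nonneg_left ?_ (by positivity)
          rw [pow_succ, sq_abs, mul_comm]
          exact mul_le_mul_of_nonneg_right hω (sq_nonneg _)
      _ = _ := by rw [integral_const_mul, ← hv]
  have hsC : s ^ 2 * C ^ 2 ≤ |s| * C := by
    have : 0 ≤ |s| * C := by positivity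
    rw [← sq_abs s]
    nlinarith
  have hsv : s ^ 2 * v ≤ |s| * C := (mul_le_mul_of_nonneg_left hvC (sq_nonneg s)).trans hsC
  have hsv0 : 0 ≤ s ^ 2 * v := by positivity
  -- The error of the exponential is at most `(s²v/2)²`; one factor `s²v` is then bounded by `|s|
  -- C`, using `v ≤ C²` and `|s| C ≤ 1`.
  have h2 : |Real.exp (-(s ^ 2 * v / 2)) - (1 - s ^ 2 * v / 2)| ≤ |s| ^ 3 * C * v := by
    have h := Real.abs_exp_sub_one_sub_id_le (x := -(s ^ 2 * v / 2))
      (by rw [abs_neg, abs_of_nonneg (by positivity)]; linarith)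
    rw [show Real.exp (-(s ^ 2 * v / 2)) - (1 - s ^ 2 * v / 2) =
      Real.exp (-(s ^ 2 * v / 2)) - 1 - -(s ^ 2 * v / 2) by ring]
    refine h.trans ?_
    rw [neg_sq]
    have : |s| ^ 3 * C * v = (s ^ 2 * v) * (|s| * C) := by rw [← sq_abs s]; ring
    rw [this]
    nlinarith
  calc _ = ‖(charFun (P.map Y) s - ((1 - s ^ 2 * v / 2 : ℝ) : ℂ)) -
        ((Real.exp (-(s ^ 2 * v / 2)) - (1 - s ^ 2 * v / 2) : ℝ) : ℂ)‖ := by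
        congr 1; push_cast; ring
    _ ≤ _ := norm_sub_le _ _
    _ ≤ |s| ^ 3 * C * v + |s| ^ 3 * C * v := by
        refine add_le_add h1 ?_
        rw [Complex.norm_real]
        exact h2
    _ = _ := by ring

end CharFun

/-! ### Processes with bounded independent increments: moments and the central limit theorem. -/

/-- `K` is a process started at `0` with increments in `[0, C]`, each of which is independent of
the present value of `K`. -/
structure HasIndepIncrements {Ω : Type*} [MeasurableSpace Ω] (P : Measure Ω) (C : ℝ)
    (K D : ℕ → Ω → ℝ) : Prop where
  zero : ∀ ω, K 0 ω = 0
  succ : ∀ t ω, K (t + 1) ω = K t ω + D t ω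
  measurable : ∀ t, Measurable (D t)
  nonneg : ∀ᵐ ω ∂P, ∀ t, 0 ≤ D t ω
  le : ∀ᵐ ω ∂P, ∀ t, D t ω ≤ C
  indep : ∀ t, IndepFun (K t) (D t) P

namespace HasIndepIncrements

variable {Ω : Type*} [MeasurableSpace Ω] {P : Measure Ω} {C : ℝ}
  {K D : ℕ → Ω → ℝ}

theorem measurable_sum (h : HasIndepIncrements P C K D) (t : ℕ) : Measurable (K t) := by
  induction t with
  | zero => rw [funext h.zero]; exact measurable_const
  | succ t ih => rw [funext (h.succ t)]; exact ih.add (h.measurable t)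

theorem integral_nonneg (h : HasIndepIncrements P C K D) (t : ℕ) : 0 ≤ ∫ ω, D t ω ∂P :=
  integral_nonneg_of_ae (by filter_upwards [h.nonneg] with ω hω using hω t)

variable [IsProbabilityMeasure P]

theorem bound_nonneg (h : HasIndepIncrements P C K D) : 0 ≤ C := by
  obtain ⟨ω, h1, h2⟩ := (h.nonneg.and h.le).exists
  exact (h1 0).trans (h2 0)

theorem memLp (h : HasIndepIncrements P C K D) (t : ℕ) : MemLp (D t) 2 P := by
  refine MemLp.of_bound (h.measurable t).aestronglyMeasurable C ?_
  filter_upwards [h.nonneg, h.le] with ω h1 h2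
  rw [Real.norm_eq_abs, abs_of_nonneg (h1 t)]
  exact h2 t

theorem memLp_sum (h : HasIndepIncrements P C K D) (t : ℕ) : MemLp (K t) 2 P := by
  induction t with
  | zero => rw [funext h.zero]; exact memLp_const _
  | succ t ih => rw [funext (h.succ t)]; exact ih.add (h.memLp t)

theorem integrable (h : HasIndepIncrements P C K D) (t : ℕ) : Integrable (D t) P :=
  (h.memLp t).integrable one_le_two

theorem integrable_sum (h : HasIndepIncrements P C K D) (t : ℕ) : Integrable (K t) P :=
  (h.memLp_sum t).integrable one_le_two

theorem integral_succ (h : HasIndepIncrements P C K D) (t : ℕ) :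
    ∫ ω, K (t + 1) ω ∂P = ∫ ω, K t ω ∂P + ∫ ω, D t ω ∂P := by
  rw [funext (h.succ t), integral_add (h.integrable_sum t) (h.integrable t)]

theorem integral_eq_sum (h : HasIndepIncrements P C K D) (t : ℕ) :
    ∫ ω, K t ω ∂P = ∑ i ∈ Finset.range t, ∫ ω, D i ω ∂P := by
  induction t with
  | zero => simp [h.zero]
  | succ t ih => rw [h.integral_succ, ih, Finset.sum_range_succ]

theorem variance_succ (h : HasIndepIncrements P C K D) (t : ℕ) :
    variance (K (t + 1)) P = variance (K t) P + variance (D t) P := by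
  rw [show K (t + 1) = K t + D t from funext (h.succ t),
    (h.indep t).variance_add (h.memLp_sum t) (h.memLp t)]

theorem variance_eq_sum (h : HasIndepIncrements P C K D) (t : ℕ) :
    variance (K t) P = ∑ i ∈ Finset.range t, variance (D i) P := by
  induction t with
  | zero =>
    rw [funext h.zero, variance_eq_integral measurable_const.aemeasurable]
    simp
  | succ t ih => rw [h.variance_succ, ih, Finset.sum_range_succ]

theorem integral_le (h : HasIndepIncrements P C K D) (t : ℕ) : ∫ ω, D t ω ∂P ≤ C := by
  calc _ ≤ ∫ _, C ∂P := integral_mono_ae (h.integrable t) (integrable_const _)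
        (by filter_upwards [h.le] with ω hω using hω t)
    _ = C := by simp

/-- For `0 ≤ D ≤ C` one has `D² ≤ C D`. -/
theorem variance_le (h : HasIndepIncrements P C K D) (t : ℕ) :
    variance (D t) P ≤ C * ∫ ω, D t ω ∂P := by
  refine (variance_le_expectation_sq (h.measurable t).aestronglyMeasurable).trans ?_
  rw [← integral_const_mul]
  refine integral_mono_ae (h.memLp t).integrable_sq ((h.integrable t).const_mul C) ?_
  filter_upwards [h.nonneg, h.le] with ω h1 h2
  simp only [Pi.pow_apply]
  nlinarith [h1 t, h2 t]

theorem variance_sum_le (h : HasIndepIncrements P C K D) (t : ℕ) :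
    variance (K t) P ≤ C * ∫ ω, K t ω ∂P := by
  rw [h.variance_eq_sum, h.integral_eq_sum, Finset.mul_sum]
  exact Finset.sum_le_sum fun i _ => h.variance_le i

/-- Lindeberg replacement by induction: characteristic functions and Gaussian factors have norm at
most 1, so `‖ab - a'b'‖ ≤ ‖a - a'‖ + ‖b - b'‖`, and the one-step errors add up like the variances.
-/
theorem norm_charFun_sub_le (h : HasIndepIncrements P C K D) {s : ℝ} (hs : |s| * C ≤ 1) (t : ℕ) :
    ‖charFun (P.map fun ω => K t ω - ∫ ω', K t ω' ∂P) s -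
      Complex.exp (-(s ^ 2 * variance (K t) P / 2 : ℝ))‖ ≤
      2 * |s| ^ 3 * C * variance (K t) P := by
  induction t with
  | zero =>
    rw [h.variance_eq_sum]
    simp [h.zero]
  | succ t ih =>
    have hm := h.measurable_sum t
    have hd := h.measurable t
    have hmap : charFun (P.map fun ω => K (t + 1) ω - ∫ ω', K (t + 1) ω' ∂P) s =
        charFun (P.map fun ω => K t ω - ∫ ω', K t ω' ∂P) s *
        charFun (P.map fun ω => D t ω - ∫ ω', D t ω' ∂P) s := by
      rw [← Pi.mul_apply, ← IndepFun.charFun_map_add_eq_mul]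
      · congr 2
        ext ω
        rw [h.integral_succ, h.succ, Pi.add_apply]
        ring
      · fun_prop
      · fun_prop
      · exact (h.indep t).comp (φ := fun x => x - ∫ ω', K t ω' ∂P)
          (ψ := fun x => x - ∫ ω', D t ω' ∂P) (by fun_prop) (by fun_prop)
    -- Centring keeps the bound `C`, since the increment and its mean both lie in `[0, C]`.
    have hstep := norm_charFun_map_sub_exp_le (P := P) (Y := fun ω => D t ω - ∫ ω', D t ω' ∂P)
      (by fun_prop) (C := C) (by
        filter_upwards [h.nonneg, h.le] with ω h1 h2
        rw [abs_le]
        constructor <;> linarith [h1 t, h2 t, h.integral_nonneg t, h.integral_le t])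
      (by rw [integral_sub (h.integrable t) (integrable_const _)]; simp) hs
    rw [variance_sub_const hd.aestronglyMeasurable] at hstep
    have : IsProbabilityMeasure (P.map fun ω => D t ω - ∫ ω', D t ω' ∂P) :=
      Measure.isProbabilityMeasure_map (by fun_prop)
    have hle1 := norm_charFun_le_one (μ := P.map fun ω => D t ω - ∫ ω', D t ω' ∂P) s
    rw [hmap, h.variance_succ]
    set a := charFun (P.map fun ω => K t ω - ∫ ω', K t ω' ∂P) s
    set b := charFun (P.map fun ω => D t ω - ∫ ω', D t ω' ∂P) s
    set a' := Complex.exp (-(s ^ 2 * variance (K t) P / 2 : ℝ)) with ha'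
    set b' := Complex.exp (-(s ^ 2 * variance (D t) P / 2 : ℝ)) with hb'
    have hexp : Complex.exp (-(s ^ 2 * (variance (K t) P + variance (D t) P) / 2 : ℝ)) =
        a' * b' := by
      rw [ha', hb', ← Complex.exp_add]
      congr 1
      push_cast
      ring
    have ha1 : ‖a'‖ ≤ 1 := by
      rw [ha', ← Complex.ofReal_neg, Complex.norm_exp_ofReal, Real.exp_le_one_iff]
      have := variance_nonneg (K t) P
      have : 0 ≤ s ^ 2 * variance (K t) P / 2 := by positivity
      linarith
    rw [hexp]
    calc ‖a * b - a' * b'‖ = ‖(a - a') * b + a' * (b - b')‖ := by congr 1; ring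
      _ ≤ ‖a - a'‖ * ‖b‖ + ‖a'‖ * ‖b - b'‖ := by
          refine (norm_add_le _ _).trans ?_
          rw [norm_mul, norm_mul]
      _ ≤ ‖a - a'‖ * 1 + 1 * ‖b - b'‖ := by gcongr
      _ ≤ _ := by linarith

/-- Lévy's continuity theorem: at `s = x/σ` the Gaussian term is exactly `exp(-x²/2)` and the error
is `2|x|³C/σ`. -/
theorem tendstoInDistribution (h : HasIndepIncrements P C K D)
    (hV : Tendsto (fun t => variance (K t) P) atTop atTop) :
    TendstoInDistribution
      (fun (t : ℕ) (ω : Ω) => (K t ω - ∫ ω', K t ω' ∂P) / Real.sqrt (variance (K t) P))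
      atTop (id : ℝ → ℝ) (fun _ => P) (gaussianReal 0 1) where
  forall_aemeasurable t :=
    (((h.measurable_sum t).sub measurable_const).div_const _).aemeasurable
  aemeasurable_limit := aemeasurable_id
  tendsto := by
    refine ProbabilityMeasure.tendsto_iff_tendsto_charFun.2 fun x => ?_
    simp only [ProbabilityMeasure.coe_mk, Measure.map_id, charFun_gaussianReal]
    have hσ : Tendsto (fun t => Real.sqrt (variance (K t) P)) atTop atTop :=
      Real.tendsto_sqrt_atTop.comp hV
    rw [tendsto_iff_norm_sub_tendsto_zero]
    refine squeeze_zero' (Eventually.of_forall fun _ => norm_nonneg _) ?_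
      (tendsto_const_nhds.div_atTop hσ : Tendsto
        (fun t => 2 * |x| ^ 3 * C / Real.sqrt (variance (K t) P)) atTop (𝓝 0))
    -- This threshold gives both `σ > 0` and the smallness condition `|x/σ| C ≤ 1`.
    filter_upwards [hσ.eventually_ge_atTop (|x| * C + 1)] with t ht
    have hC := h.bound_nonneg
    set σ := Real.sqrt (variance (K t) P) with hσdef
    have hσ0 : 0 < σ := by
      have : 0 ≤ |x| * C := by positivity
      linarith
    have hσ2 : variance (K t) P = σ ^ 2 := (Real.sq_sqrt (variance_nonneg _ _)).symm
    have hmap : charFun (P.map fun ω => (K t ω - ∫ ω', K t ω' ∂P) / σ) x =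
        charFun (P.map fun ω => K t ω - ∫ ω', K t ω' ∂P) (σ⁻¹ * x) := by
      rw [← charFun_map_mul_comp (f := fun ω => K t ω - ∫ ω', K t ω' ∂P)
        ((h.measurable_sum t).sub measurable_const).aemeasurable]
      congr 2
      ext ω
      rw [div_eq_inv_mul]
    rw [hmap]
    have habs : |σ⁻¹ * x| = |x| / σ := by
      rw [abs_mul, abs_inv, abs_of_pos hσ0, inv_mul_eq_div]
    have hb := h.norm_charFun_sub_le (s := σ⁻¹ * x)
      (by rw [habs, div_mul_eq_mul_div, div_le_one hσ0]; linarith) t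
    rw [habs, hσ2] at hb
    have e1 : 2 * (|x| / σ) ^ 3 * C * σ ^ 2 = 2 * |x| ^ 3 * C / σ := by field_simp
    have e2 : (σ⁻¹ * x) ^ 2 * σ ^ 2 / 2 = x ^ 2 / 2 := by field_simp
    rw [e1, e2] at hb
    refine le_trans (le_of_eq ?_) hb
    congr 2
    push_cast
    simp

end HasIndepIncrements

/-! ### Almost sure convergence of the process divided by its mean. -/

/-- By Tonelli the sum of the squares has finite expectation, so it is almost surely finite and its
terms tend to 0. -/
theorem ae_tendsto_zero_of_summable_integral_sq {Ω : Type*} [MeasurableSpace Ω] {P : Measure Ω}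
    {Y : ℕ → Ω → ℝ} (hY : ∀ k, Measurable (Y k)) (hint : ∀ k, Integrable (fun ω => Y k ω ^ 2) P)
    (hsum : Summable fun k => ∫ ω, Y k ω ^ 2 ∂P) :
    ∀ᵐ ω ∂P, Tendsto (fun k => Y k ω) atTop (𝓝 0) := by
  have hfin : ∫⁻ ω, ∑' k, ENNReal.ofReal (Y k ω ^ 2) ∂P ≠ ⊤ := by
    rw [lintegral_tsum fun k => by fun_prop]
    simp_rw [← ofReal_integral_eq_lintegral_ofReal (hint _) (ae_of_all _ fun ω => sq_nonneg _)]
    exact hsum.tsum_ofReal_ne_top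
  filter_upwards [ae_lt_top (Measurable.tsum fun k => by fun_prop) hfin] with ω hω
  have h := ENNReal.tendsto_atTop_zero_of_tsum_ne_top hω.ne
  have h2 : Tendsto (fun k => Y k ω ^ 2) atTop (𝓝 0) := by
    have := (ENNReal.tendsto_toReal ENNReal.zero_ne_top).comp h
    simpa [Function.comp_def, ENNReal.toReal_ofReal, sq_nonneg] using this
  have h3 := (Real.continuous_sqrt.tendsto 0).comp h2
  rw [tendsto_zero_iff_abs_tendsto_zero]
  simpa [Function.comp_def, Real.sqrt_sq_eq_abs] using h3

/-- With `k = ⌊√(a t)⌋` one has `τ k ≤ t ≤ τ (k+1)`, so monotonicity puts `u t / a t` between `u (τ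
k)/(k+1)²` and `u (τ (k+1))/k²`. Both tend to 1 because consecutive squares are asymptotically
equal. -/
theorem tendsto_div_of_monotone_of_subseq {a u : ℕ → ℝ} (ha : Monotone a) (hu : Monotone u)
    (ha0 : ∀ t, 0 ≤ a t) (hu0 : ∀ t, 0 ≤ u t) (htop : Tendsto a atTop atTop) {τ : ℕ → ℕ}
    (hτ : ∀ k : ℕ, (k : ℝ) ^ 2 ≤ a (τ k)) (hmin : ∀ (k : ℕ) t, (k : ℝ) ^ 2 ≤ a t → τ k ≤ t)
    (hlim : Tendsto (fun k : ℕ => u (τ k) / (k : ℝ) ^ 2) atTop (𝓝 1)) :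
    Tendsto (fun t => u t / a t) atTop (𝓝 1) := by
  have hk : Tendsto (fun t => ⌊Real.sqrt (a t)⌋₊) atTop atTop :=
    tendsto_nat_floor_atTop.comp (Real.tendsto_sqrt_atTop.comp htop)
  have hratio : Tendsto (fun k : ℕ => ((k : ℝ) / (k + 1)) ^ 2) atTop (𝓝 1) := by
    simpa using (tendsto_natCast_div_add_atTop (1 : ℝ)).pow 2
  have hlow : Tendsto (fun k : ℕ => u (τ k) / ((k : ℝ) + 1) ^ 2) atTop (𝓝 1) := by
    have h := hlim.mul hratio
    rw [one_mul] at h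
    refine h.congr' ?_
    filter_upwards [eventually_gt_atTop 0] with k hk
    have : (k : ℝ) ≠ 0 := by positivity
    field_simp
  have hup : Tendsto (fun k : ℕ => u (τ (k + 1)) / (k : ℝ) ^ 2) atTop (𝓝 1) := by
    have h := ((tendsto_add_atTop_iff_nat 1).2 hlim).div hratio one_ne_zero
    rw [div_one] at h
    refine h.congr' ?_
    filter_upwards [eventually_gt_atTop 0] with k hk
    have : (k : ℝ) ≠ 0 := by positivity
    have : (k : ℝ) + 1 ≠ 0 := by positivity
    push_cast
    simp only [Pi.div_apply]
    field_simp
  refine tendsto_of_tendsto_of_tendsto_of_le_of_le' (hlow.comp hk) (hup.comp hk) ?_ ?_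
  · filter_upwards [htop.eventually_gt_atTop 0] with t ht
    simp only [Function.comp_apply]
    set k := ⌊Real.sqrt (a t)⌋₊
    have h1 : (k : ℝ) ^ 2 ≤ a t :=
      (Real.le_sqrt (Nat.cast_nonneg _) (ha0 t)).1 (Nat.floor_le (Real.sqrt_nonneg _))
    have h2 : a t ≤ ((k : ℝ) + 1) ^ 2 := by
      rw [← Real.sqrt_le_left (by positivity)]
      exact (Nat.lt_floor_add_one _).le
    exact div_le_div₀ (hu0 t) (hu (hmin k t h1)) ht h2
  · filter_upwards [hk.eventually_gt_atTop 0] with t hkt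
    simp only [Function.comp_apply]
    set k := ⌊Real.sqrt (a t)⌋₊
    have h1 : (k : ℝ) ^ 2 ≤ a t :=
      (Real.le_sqrt (Nat.cast_nonneg _) (ha0 t)).1 (Nat.floor_le (Real.sqrt_nonneg _))
    have h2 : a t < ((k : ℝ) + 1) ^ 2 := by
      rw [← Real.sqrt_lt' (by positivity)]
      exact Nat.lt_floor_add_one _
    have h3 : t ≤ τ (k + 1) := by
      by_contra! hlt
      have := hτ (k + 1)
      push_cast at this
      linarith [ha hlt.le]
    exact div_le_div₀ (hu0 _) (hu h3) (by positivity) h1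

namespace HasIndepIncrements

variable {Ω : Type*} [MeasurableSpace Ω] {P : Measure Ω} [IsProbabilityMeasure P] {C : ℝ}
  {K D : ℕ → Ω → ℝ}

theorem ae_tendsto_div_integral (h : HasIndepIncrements P C K D)
    (hE : Tendsto (fun t => ∫ ω, K t ω ∂P) atTop atTop) :
    ∀ᵐ ω ∂P, Tendsto (fun t : ℕ => K t ω / ∫ ω', K t ω' ∂P) atTop (𝓝 1) := by
  set a : ℕ → ℝ := fun t => ∫ ω, K t ω ∂P with ha
  have hC := h.bound_nonneg
  have hmono : Monotone a := monotone_nat_of_le_succ fun t => by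
    simp only [ha, h.integral_succ]
    linarith [h.integral_nonneg t]
  have ha0 : a 0 = 0 := by simp [ha, h.zero]
  have hnn : ∀ t, 0 ≤ a t := fun t => ha0 ▸ hmono (Nat.zero_le t)
  have hex : ∀ k : ℕ, ∃ t, (k : ℝ) ^ 2 ≤ a t := fun k => (hE.eventually_ge_atTop _).exists
  classical
  set τ : ℕ → ℕ := fun k => Nat.find (hex k) with hτdef
  have hτ : ∀ k : ℕ, (k : ℝ) ^ 2 ≤ a (τ k) := fun k => Nat.find_spec (hex k)
  have hmin : ∀ (k : ℕ) t, (k : ℝ) ^ 2 ≤ a t → τ k ≤ t := fun k t => Nat.find_min' (hex k)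
  -- The mean lies below `k²` one step before `τ k`, and a single step adds at most `C`.
  have hτle : ∀ k : ℕ, a (τ k) ≤ (k : ℝ) ^ 2 + C := by
    intro k
    obtain h0 | ⟨j, hj⟩ : τ k = 0 ∨ ∃ j, τ k = j + 1 := by
      cases τ k <;> simp
    · rw [h0, ha0]; positivity
    · have hlt : a j < (k : ℝ) ^ 2 := by
        by_contra! hle
        have := hmin k j hle
        omega
      rw [hj]
      simp only [ha, h.integral_succ]
      linarith [h.integral_le j]
  have hsq : Tendsto (fun k : ℕ => (k : ℝ) ^ 2) atTop atTop :=
    (tendsto_pow_atTop two_ne_zero).comp tendsto_natCast_atTop_atTop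
  have haτ : Tendsto (fun k : ℕ => a (τ k) / (k : ℝ) ^ 2) atTop (𝓝 1) := by
    have hup : Tendsto (fun k : ℕ => 1 + C / (k : ℝ) ^ 2) atTop (𝓝 1) := by
      simpa using ((tendsto_const_nhds (x := C)).div_atTop hsq).const_add 1
    refine tendsto_of_tendsto_of_tendsto_of_le_of_le' tendsto_const_nhds hup ?_ ?_
    · filter_upwards [hsq.eventually_gt_atTop 0] with k hk
      rw [one_le_div hk]
      exact hτ k
    · filter_upwards [hsq.eventually_gt_atTop 0] with k hk
      rw [div_le_iff₀ hk, add_mul, one_mul, div_mul_cancel₀ _ hk.ne']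
      exact hτle k
  have hdev : ∀ᵐ ω ∂P,
      Tendsto (fun k : ℕ => (K (τ k) ω - a (τ k)) / (k : ℝ) ^ 2) atTop (𝓝 0) := by
    have hsqI : ∀ t, Integrable (fun ω => (K t ω - a t) ^ 2) P := fun t =>
      ((h.memLp_sum t).sub (memLp_const _)).integrable_sq
    refine ae_tendsto_zero_of_summable_integral_sq
      (fun k => ((h.measurable_sum _).sub measurable_const).div_const _) ?_ ?_
    · intro k
      simp_rw [div_pow]
      exact (hsqI _).div_const _
    · have hs : Summable fun k : ℕ => C * (1 + C) * (1 / (k : ℝ) ^ 2) :=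
        (Real.summable_one_div_nat_pow.2 one_lt_two).mul_left _
      refine Summable.of_nonneg_of_le (fun k => MeasureTheory.integral_nonneg fun ω => sq_nonneg _) ?_ hs
      intro k
      simp_rw [div_pow]
      rw [integral_div, ← variance_eq_integral (h.measurable_sum _).aemeasurable]
      obtain rfl | hk := Nat.eq_zero_or_pos k
      · simp
      have hk1 : (1 : ℝ) ≤ (k : ℝ) ^ 2 := by
        exact one_le_pow₀ (by exact_mod_cast hk)
      have hv : variance (K (τ k)) P ≤ C * ((k : ℝ) ^ 2 + C) :=
        (h.variance_sum_le _).trans (mul_le_mul_of_nonneg_left (hτle k) hC)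
      rw [mul_one_div, div_le_div_iff₀ (by positivity) (by positivity)]
      have : variance (K (τ k)) P ≤ C * (1 + C) * (k : ℝ) ^ 2 := by
        refine hv.trans ?_
        rw [mul_assoc]
        refine mul_le_mul_of_nonneg_left ?_ hC
        nlinarith
      calc _ ≤ C * (1 + C) * (k : ℝ) ^ 2 * (k : ℝ) ^ 2 := by gcongr
        _ = _ := by ring
  filter_upwards [hdev, h.nonneg] with ω hω hnnω
  have hKmono : Monotone fun t => K t ω := monotone_nat_of_le_succ fun t => by
    simp only [h.succ]
    linarith [hnnω t]
  refine tendsto_div_of_monotone_of_subseq hmono hKmono hnn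
    (fun t => (h.zero ω).symm.le.trans (hKmono (Nat.zero_le t))) hE hτ hmin ?_
  have := hω.add haτ
  rw [zero_add] at this
  refine this.congr fun k => ?_
  rw [← add_div, sub_add_cancel]

end HasIndepIncrements

/-! ### The transition law and the increments of the cycle count. -/

instance : Countable MCycle :=
  Function.Injective.countable (f := fun c : MCycle => (c.xs, c.y)) fun c d h => by
    rw [Prod.mk.injEq] at h
    exact MCycle.ext h.1 h.2

/-- Countability reduces equality of measures on states, and on finite histories, to singletons,
which is what the Markov property describes. -/
instance (n : ℕ → ℕ) (t : ℕ) : Countable (MultisetPerm n t) :=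
  Function.Injective.countable (f := MultisetPerm.cycles) fun _ _ h => MultisetPerm.ext h

instance (n : ℕ → ℕ) (t : ℕ) : DiscreteMeasurableSpace (MultisetPerm n t) :=
  ⟨fun _ => trivial⟩

theorem MultisetPerm.numCycles_extend {n : ℕ → ℕ} {t : ℕ} (π : MultisetPerm n t)
    (k : Fin (n (t + 1) + 1)) (s : Sym (Place π.cycles) (n (t + 1) - k)) :
    (π.extend k s).numCycles = π.numCycles + k := by
  simp [MultisetPerm.numCycles, MultisetPerm.extend, insertCopies]

/-- The number of insertion places does not depend on the cycle structure; this is the source of the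
independence of the increments. -/
theorem MultisetPerm.card_place {n : ℕ → ℕ} {t : ℕ} (π : MultisetPerm n t) :
    Fintype.card (Place π.cycles) = totalSize n t := by
  have h := congrArg Multiset.card π.content
  have h1 : Multiset.card (baseMultiset n t) = totalSize n t := by
    simp [baseMultiset, totalSize]
  have h2 : ∀ l : List MCycle,
      Multiset.card ((l.map fun c => (c.word : Multiset ℕ)).sum) =
        (l.map fun c => c.xs.length + 1).sum := by
    intro l
    induction l with
    | nil => simp
    | cons c l ih =>
      rw [List.map_cons, List.sum_cons, Multiset.card_add, ih]
      simp [MCycle.word]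
  rw [h1, h2] at h
  rw [← h, Fintype.card_sigma]
  simp only [Fintype.card_fin]
  rw [← List.sum_ofFn]
  congr 1
  conv_rhs => rw [← List.ofFn_get π.cycles, List.map_ofFn]
  rfl

theorem MultisetPerm.numCycles_zero {n : ℕ → ℕ} (π : MultisetPerm n 0) : π.numCycles = 0 := by
  have h := π.card_place
  have h0 : totalSize n 0 = 0 := by simp [totalSize]
  rw [h0, Fintype.card_eq_zero_iff] at h
  by_contra hne
  exact h.elim ⟨⟨0, Nat.pos_of_ne_zero hne⟩, 0⟩

/-- The law of the number of new singleton cycles when `m` copies are inserted into a permutation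
with `N` entries. -/
noncomputable def newCycleLaw (θ : ℝ) (N m : ℕ) : Measure ℝ :=
  ∑ k ∈ Finset.range (m + 1), ENNReal.ofReal (newCycleProb θ N m k) • Measure.dirac (k : ℝ)

theorem integral_newCycleLaw {θ : ℝ} (hθ : 0 < θ) (N m : ℕ) (f : ℝ → ℝ) :
    ∫ x, f x ∂(newCycleLaw θ N m) =
      ∑ k ∈ Finset.range (m + 1), newCycleProb θ N m k * f k := by
  rw [newCycleLaw, integral_finsetSum_measure]
  · refine Finset.sum_congr rfl fun k _ => ?_
    rw [integral_smul_measure, integral_dirac, ENNReal.toReal_ofReal (newCycleProb_nonneg hθ N m k),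
      smul_eq_mul]
  · intro k _
    exact (integrable_dirac (by simp)).smul_measure ENNReal.ofReal_ne_top

theorem ae_newCycleLaw (θ : ℝ) (N m : ℕ) : ∀ᵐ x ∂(newCycleLaw θ N m), 0 ≤ x ∧ x ≤ (m : ℝ) := by
  rw [newCycleLaw, ae_iff]
  simp only [Measure.coe_finsetSum, Finset.sum_apply, Measure.smul_apply, smul_eq_mul]
  refine Finset.sum_eq_zero fun k hk => ?_
  rw [Finset.mem_range] at hk
  rw [Measure.dirac_apply]
  simp [Nat.lt_succ_iff.1 hk]

/-- The transition kernel of the process, as a measure. -/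
noncomputable def transitionMeasure (θ : ℝ) {n : ℕ → ℕ} {t : ℕ} (π : MultisetPerm n t) :
    Measure (MultisetPerm n (t + 1)) :=
  ∑ k : Fin (n (t + 1) + 1), ∑ s : Sym (Place π.cycles) (n (t + 1) - k),
    ENNReal.ofReal (θ ^ (k : ℕ) / normalizer θ n t) • Measure.dirac (π.extend k s)

theorem normalizer_pos {θ : ℝ} (hθ : 0 < θ) (n : ℕ → ℕ) (t : ℕ) : 0 < normalizer θ n t :=
  sum_multichoose_mul_pow_pos hθ _ _

theorem transitionMeasure_singleton {θ : ℝ} (hθ : 0 < θ) {n : ℕ → ℕ} {t : ℕ}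
    (π : MultisetPerm n t) (π' : MultisetPerm n (t + 1)) :
    transitionMeasure θ π {π'} = ENNReal.ofReal (transitionProb θ π π') := by
  classical
  have hpos : ∀ k : ℕ, 0 ≤ θ ^ k / normalizer θ n t := fun k =>
    div_nonneg (by positivity) (normalizer_pos hθ n t).le
  rw [transitionMeasure, transitionProb, ENNReal.ofReal_sum_of_nonneg fun k _ =>
    Finset.sum_nonneg fun s _ => by split_ifs <;> simp [hpos]]
  simp only [Measure.coe_finsetSum, Finset.sum_apply, Measure.smul_apply, smul_eq_mul]
  refine Finset.sum_congr rfl fun k _ => ?_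
  rw [ENNReal.ofReal_sum_of_nonneg fun s _ => by split_ifs <;> simp [hpos]]
  refine Finset.sum_congr rfl fun s _ => ?_
  rw [Measure.dirac_apply]
  by_cases h : π.extend k s = π' <;> simp [h]

/-- All `multichoose N_t (m-k)` extensions with `k` new cycles have the same weight, so the law of
the increment forgets `π`. -/
theorem transitionMeasure_preimage (θ : ℝ) {n : ℕ → ℕ} {t : ℕ} (hθ : 0 < θ)
    (π : MultisetPerm n t) {B : Set ℝ} (hB : MeasurableSet B) :
    transitionMeasure θ π {π' | (π'.numCycles : ℝ) - π.numCycles ∈ B} =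
      newCycleLaw θ (totalSize n t) (n (t + 1)) B := by
  classical
  have hF := (normalizer_pos hθ n t)
  rw [transitionMeasure, newCycleLaw]
  simp only [Measure.coe_finsetSum, Finset.sum_apply, Measure.smul_apply, smul_eq_mul]
  rw [Finset.sum_range]
  refine Finset.sum_congr rfl fun k _ => ?_
  have h1 : ∀ s : Sym (Place π.cycles) (n (t + 1) - k), Measure.dirac (π.extend k s)
      {π' : MultisetPerm n (t + 1) | (π'.numCycles : ℝ) - π.numCycles ∈ B} =
      Measure.dirac ((k : ℕ) : ℝ) B := by
    intro s
    rw [Measure.dirac_apply, Measure.dirac_apply' _ hB]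
    simp [Set.indicator, MultisetPerm.numCycles_extend]
  simp only [h1, Finset.sum_const, nsmul_eq_mul, Finset.card_univ]
  rw [Sym.card_sym_eq_multichoose, π.card_place, ← mul_assoc]
  congr 1
  rw [← ENNReal.ofReal_natCast, ← ENNReal.ofReal_mul (Nat.cast_nonneg _), newCycleProb,
    mul_div_assoc]
  rfl

section Chain

variable {Ω : Type*} [MeasurableSpace Ω] {P : Measure Ω} {θ : ℝ}
  {n : ℕ → ℕ} {X : (t : ℕ) → Ω → MultisetPerm n t}

theorem IsCRP.measurable_increment (hX : IsCRP P θ n X) (t : ℕ) :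
    Measurable fun ω => ((X (t + 1) ω).numCycles : ℝ) - (X t ω).numCycles :=
  ((Measurable.of_discrete (f := fun π : MultisetPerm n (t + 1) => (π.numCycles : ℝ))).comp
    (hX.measurable (t + 1))).sub
  ((Measurable.of_discrete (f := fun π : MultisetPerm n t => (π.numCycles : ℝ))).comp
    (hX.measurable t))

variable [IsProbabilityMeasure P]

theorem IsCRP.map_restrict_history (hX : IsCRP P θ n X) (hθ : 0 < θ) (t : ℕ)
    (h : (s : Fin (t + 1)) → MultisetPerm n s) :
    (P.restrict {ω | ∀ s : Fin (t + 1), X s ω = h s}).map (X (t + 1)) =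
      P {ω | ∀ s : Fin (t + 1), X s ω = h s} • transitionMeasure θ (h (Fin.last t)) := by
  have hXm := hX.measurable
  refine Measure.ext_of_singleton fun π' => ?_
  rw [Measure.map_apply (hXm _) (measurableSet_singleton _),
    Measure.restrict_apply (hXm _ (measurableSet_singleton _)), Measure.smul_apply, smul_eq_mul,
    transitionMeasure_singleton hθ]
  -- The Markov property is stated for an infinite sequence of states. When the history occurs, the
  -- path of some `ω₀` in it supplies the states beyond time `t + 1`; otherwise both sides vanish.
  obtain he | ⟨ω₀, hω₀⟩ := Set.eq_empty_or_nonempty {ω | ∀ s : Fin (t + 1), X s ω = h s}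
  · simp [he]
  set π : (s : ℕ) → MultisetPerm n s := Function.update (fun s => X s ω₀) (t + 1) π'
  have hπ : ∀ s ≤ t, π s = X s ω₀ := fun s hs =>
    Function.update_of_ne (by omega) _ _
  have hπ' : π (t + 1) = π' := Function.update_self _ _ _
  have hh : ∀ s : Fin (t + 1), h s = X s ω₀ := fun s => (hω₀ s).symm
  have hA : {ω | ∀ s : Fin (t + 1), X s ω = h s} = {ω | ∀ s ≤ t, X s ω = π s} := by
    ext ω
    constructor
    · intro hω s hs
      rw [hπ s hs, ← hh ⟨s, by omega⟩]
      exact hω ⟨s, by omega⟩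
    · intro hω s
      rw [hh, ← hπ s (by omega)]
      exact hω s (by omega)
  have hA' : X (t + 1) ⁻¹' {π'} ∩ {ω | ∀ s : Fin (t + 1), X s ω = h s} =
      {ω | ∀ s ≤ t + 1, X s ω = π s} := by
    rw [hA]
    ext ω
    constructor
    · rintro ⟨h1, h2⟩ s hs
      obtain hs | rfl := Nat.le_succ_iff.1 hs
      · exact h2 s hs
      · rw [hπ']; exact h1
    · intro hω
      refine ⟨?_, fun s hs => hω s (by omega)⟩
      rw [Set.mem_preimage, Set.mem_singleton_iff, ← hπ']
      exact hω _ le_rfl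
  have hlast : h (Fin.last t) = π t := by rw [hπ t le_rfl]; exact hh (Fin.last t)
  have hm := hX.markov t π
  rw [hA', hA, hlast, ← ofReal_measureReal (μ := P) (s := {ω | ∀ s ≤ t + 1, X s ω = π s}), hm,
    ENNReal.ofReal_mul measureReal_nonneg, ofReal_measureReal, hπ']

/-- The increment is independent of the whole history: given any history, its conditional law is the
same `newCycleLaw`, so restricting to `B` only rescales the law of the history. -/
theorem IsCRP.map_restrict_increment (hX : IsCRP P θ n X) (hθ : 0 < θ) (t : ℕ)
    {B : Set ℝ} (hB : MeasurableSet B) :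
    (P.restrict {ω | ((X (t + 1) ω).numCycles : ℝ) - (X t ω).numCycles ∈ B}).map
        (fun ω (s : Fin (t + 1)) => X s ω) =
      newCycleLaw θ (totalSize n t) (n (t + 1)) B •
        P.map (fun ω (s : Fin (t + 1)) => X s ω) := by
  have hXm := hX.measurable
  have hH : Measurable fun ω (s : Fin (t + 1)) => X s ω :=
    measurable_pi_lambda _ fun s => hXm s
  refine Measure.ext_of_singleton fun h => ?_
  have hA : (fun ω (s : Fin (t + 1)) => X s ω) ⁻¹' {h} =
      {ω | ∀ s : Fin (t + 1), X s ω = h s} := by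
    ext ω
    exact funext_iff
  have hAm := hH (measurableSet_singleton h)
  rw [Measure.smul_apply, Measure.map_apply hH (measurableSet_singleton _),
    Measure.map_apply hH (measurableSet_singleton _), Measure.restrict_apply hAm]
  have hm := congrArg
    (fun μ => μ {π' : MultisetPerm n (t + 1) |
      (π'.numCycles : ℝ) - MultisetPerm.numCycles (t := t) (h (Fin.last t)) ∈ B}) (hX.map_restrict_history hθ t h)
  simp only [Measure.smul_apply] at hm
  rw [hA] at hAm ⊢
  rw [transitionMeasure_preimage θ hθ (t := t) (h (Fin.last t)) hB, Measure.map_apply (hXm _) (MeasurableSet.of_discrete),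
    Measure.restrict_apply (hXm _ MeasurableSet.of_discrete)] at hm
  rw [smul_eq_mul, mul_comm, ← smul_eq_mul]
  refine Eq.trans ?_ hm
  congr 1
  ext ω
  simp only [Set.mem_inter_iff, Set.mem_ofPred_eq, Set.mem_preimage]
  rw [and_comm]
  refine and_congr_left fun hω => ?_
  have h2 : X t ω = h (Fin.last t) := hω (Fin.last t)
  rw [h2]

theorem IsCRP.measure_history_inter_increment (hX : IsCRP P θ n X) (hθ : 0 < θ) (t : ℕ)
    {B : Set ℝ} (hB : MeasurableSet B) (S : Set (MultisetPerm n t)) :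
    P (X t ⁻¹' S ∩ {ω | ((X (t + 1) ω).numCycles : ℝ) - (X t ω).numCycles ∈ B}) =
      P (X t ⁻¹' S) * newCycleLaw θ (totalSize n t) (n (t + 1)) B := by
  have hXm := hX.measurable
  have hH : Measurable fun ω (s : Fin (t + 1)) => X s ω :=
    measurable_pi_lambda _ fun s => hXm s
  have hS : MeasurableSet {h : (s : Fin (t + 1)) → MultisetPerm n s | h (Fin.last t) ∈ S} :=
    measurable_pi_apply (Fin.last t) MeasurableSet.of_discrete
  have hm := congrArg (fun μ => μ {h | h (Fin.last t) ∈ S}) (hX.map_restrict_increment hθ t hB)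
  simp only [Measure.smul_apply] at hm
  rw [Measure.map_apply hH hS, Measure.map_apply hH hS, Measure.restrict_apply (hH hS),
    smul_eq_mul, mul_comm] at hm
  exact hm

theorem IsCRP.map_increment (hX : IsCRP P θ n X) (hθ : 0 < θ) (t : ℕ) :
    P.map (fun ω => ((X (t + 1) ω).numCycles : ℝ) - (X t ω).numCycles) =
      newCycleLaw θ (totalSize n t) (n (t + 1)) := by
  ext B hB
  rw [Measure.map_apply (hX.measurable_increment t) hB]
  have h := hX.measure_history_inter_increment hθ t hB Set.univ
  rwa [Set.preimage_univ, Set.univ_inter, measure_univ, one_mul] at h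

theorem IsCRP.indepFun_increment (hX : IsCRP P θ n X) (hθ : 0 < θ) (t : ℕ) :
    IndepFun (X t) (fun ω => ((X (t + 1) ω).numCycles : ℝ) - (X t ω).numCycles) P := by
  rw [indepFun_iff_measure_inter_preimage_eq_mul]
  intro S B _ hB
  rw [← Measure.map_apply (hX.measurable_increment t) hB, hX.map_increment hθ]
  exact hX.measure_history_inter_increment hθ t hB S

theorem IsCRP.hasIndepIncrements (hX : IsCRP P θ n X) (hθ : 0 < θ) {C : ℕ}
    (hC : ∀ i ≥ 1, n i ≤ C) :
    HasIndepIncrements P C (fun t ω => ((X t ω).numCycles : ℝ))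
      (fun t ω => ((X (t + 1) ω).numCycles : ℝ) - (X t ω).numCycles) := by
  have hae : ∀ᵐ ω ∂P, ∀ t, 0 ≤ ((X (t + 1) ω).numCycles : ℝ) - (X t ω).numCycles ∧
      ((X (t + 1) ω).numCycles : ℝ) - (X t ω).numCycles ≤ C := by
    rw [ae_all_iff]
    intro t
    have h := ae_newCycleLaw θ (totalSize n t) (n (t + 1))
    rw [← hX.map_increment hθ] at h
    filter_upwards [ae_of_ae_map (hX.measurable_increment t).aemeasurable h] with ω hω
    refine ⟨hω.1, hω.2.trans ?_⟩
    exact_mod_cast hC (t + 1) (by omega)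
  exact
    { zero := fun ω => by rw [MultisetPerm.numCycles_zero, Nat.cast_zero]
      succ := fun t ω => by ring
      measurable := hX.measurable_increment
      nonneg := hae.mono fun ω hω t => (hω t).1
      le := hae.mono fun ω hω t => (hω t).2
      indep := fun t => (hX.indepFun_increment hθ t).comp
        (φ := fun π : MultisetPerm n t => (π.numCycles : ℝ)) Measurable.of_discrete
        measurable_id }

theorem IsCRP.integral_comp_increment (hX : IsCRP P θ n X) (hθ : 0 < θ) (t : ℕ) {f : ℝ → ℝ}
    (hf : Measurable f) :
    ∫ ω, f (((X (t + 1) ω).numCycles : ℝ) - (X t ω).numCycles) ∂P =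
      ∑ k ∈ Finset.range (n (t + 1) + 1), newCycleProb θ (totalSize n t) (n (t + 1)) k * f k := by
  rw [← integral_newCycleLaw hθ, ← hX.map_increment hθ,
    integral_map (hX.measurable_increment t).aemeasurable hf.aestronglyMeasurable]

end Chain

/-! ### Mean and variance of the increments in the process. -/

theorem sameOrder_sum_log {u : ℕ → ℝ} {c A : ℝ} (hc : 0 < c) (hA : 0 < A) (h0 : 0 ≤ u 0)
    (hlow : ∀ i ≥ 1, c / i ≤ u i) (hup : ∀ i ≥ 1, u i ≤ A / i) :
    SameOrder (fun t => ∑ i ∈ Finset.range t, u i) (fun t => Real.log t) := by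
  have hlog2 : 0 < Real.log 2 := Real.log_pos one_lt_two
  have hharm : ∀ (b : ℝ) (t : ℕ),
      ∑ i ∈ Finset.range t, b / ((i + 1 : ℕ) : ℝ) = b * (harmonic t : ℝ) := by
    intro b t
    simp [harmonic, Finset.mul_sum, div_eq_mul_inv]
  -- Below, `log (r+1) ≤ H_r` with `t = r + 1` gives the constant `c` directly. Above, `H_r ≤ 1 +
  -- log r` leaves the additive constant `u 0 + A`, absorbed using `log t ≥ log 2`; the term `u 0`
  -- has no bound of the form `A / i`.
  refine ⟨c, hc, (u 0 + A) / Real.log 2 + A, by positivity, fun t ht => ?_⟩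
  obtain ⟨r, rfl⟩ : ∃ r, t = r + 1 := ⟨t - 1, by omega⟩
  have hr : 1 ≤ r := by omega
  dsimp only
  rw [Finset.sum_range_succ']
  constructor
  · have h1 : ∑ i ∈ Finset.range r, c / ((i + 1 : ℕ) : ℝ) ≤ ∑ i ∈ Finset.range r, u (i + 1) :=
      Finset.sum_le_sum fun i _ => hlow (i + 1) (by omega)
    rw [hharm] at h1
    have h2 := mul_le_mul_of_nonneg_left (log_add_one_le_harmonic r) hc.le
    linarith
  · have h1 : ∑ i ∈ Finset.range r, u (i + 1) ≤ ∑ i ∈ Finset.range r, A / ((i + 1 : ℕ) : ℝ) :=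
      Finset.sum_le_sum fun i _ => hup (i + 1) (by omega)
    rw [hharm] at h1
    have h2 := mul_le_mul_of_nonneg_left (harmonic_le_one_add_log r) hA.le
    have h3 : Real.log r ≤ Real.log (r + 1 : ℕ) :=
      Real.log_le_log (by exact_mod_cast hr) (by exact_mod_cast Nat.le_succ r)
    have h4 : Real.log 2 ≤ Real.log (r + 1 : ℕ) :=
      Real.log_le_log two_pos (by exact_mod_cast ht)
    have h5 : u 0 + A ≤ (u 0 + A) / Real.log 2 * Real.log (r + 1 : ℕ) := by
      rw [div_mul_eq_mul_div, le_div_iff₀ hlog2]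
      exact mul_le_mul_of_nonneg_left h4 (by positivity)
    rw [add_mul]
    nlinarith

theorem SameOrder.tendsto_atTop {a : ℕ → ℝ} (h : SameOrder a fun t => Real.log t) :
    Tendsto a atTop atTop := by
  obtain ⟨c, hc, _, _, h⟩ := h
  refine tendsto_atTop_mono' _ ?_ (Tendsto.const_mul_atTop hc
    (Real.tendsto_log_atTop.comp tendsto_natCast_atTop_atTop))
  filter_upwards [eventually_ge_atTop 2] with t ht using (h t ht).1

theorem le_totalSize {n : ℕ → ℕ} (hn : ∀ i ≥ 1, 1 ≤ n i) (t : ℕ) : t ≤ totalSize n t := by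
  have := Finset.card_nsmul_le_sum (Finset.Icc 1 t) n 1 fun i hi => hn i (Finset.mem_Icc.1 hi).1
  simpa [totalSize] using this

theorem totalSize_le {n : ℕ → ℕ} {C : ℕ} (hn : ∀ i ≥ 1, n i ≤ C) (t : ℕ) :
    totalSize n t ≤ t * C := by
  have := Finset.sum_le_card_nsmul (Finset.Icc 1 t) n C fun i hi => hn i (Finset.mem_Icc.1 hi).1
  simpa [totalSize] using this

section Increments

variable {Ω : Type*} [MeasurableSpace Ω] {P : Measure Ω} [IsProbabilityMeasure P] {θ : ℝ}
  {n : ℕ → ℕ} {X : (t : ℕ) → Ω → MultisetPerm n t}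

theorem IsCRP.integral_increment (hX : IsCRP P θ n X) (hθ : 0 < θ) (t : ℕ) :
    ∫ ω, (((X (t + 1) ω).numCycles : ℝ) - (X t ω).numCycles) ∂P =
      ∑ k ∈ Finset.range (n (t + 1) + 1), newCycleProb θ (totalSize n t) (n (t + 1)) k * k :=
  hX.integral_comp_increment hθ t measurable_id

theorem IsCRP.integral_increment_le (hX : IsCRP P θ n X) (hθ : 0 < θ) {C : ℕ}
    (hn : ∀ i ≥ 1, 1 ≤ n i) (hC : ∀ i ≥ 1, n i ≤ C) {t : ℕ} (ht : 1 ≤ t) :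
    ∫ ω, (((X (t + 1) ω).numCycles : ℝ) - (X t ω).numCycles) ∂P ≤ C * (θ * C) / t := by
  have hN := le_totalSize hn t
  have ht' : (0 : ℝ) < t := by exact_mod_cast ht
  have hN' : (t : ℝ) ≤ totalSize n t := by exact_mod_cast hN
  rw [hX.integral_increment hθ]
  refine (sum_mul_newCycleProb_le hθ (ht.trans hN) (hC _ (by omega))).trans ?_
  rw [mul_div_assoc (C : ℝ)]
  gcongr

theorem newCycleProb_one_ge_div (hθ : 0 < θ) {C : ℕ} (hn : ∀ i ≥ 1, 1 ≤ n i)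
    (hC : ∀ i ≥ 1, n i ≤ C) {t : ℕ} (ht : 1 ≤ t) :
    newCycleProb θ (totalSize n t) (n (t + 1)) 0 * (θ / (2 * C)) / t ≤
      newCycleProb θ (totalSize n t) (n (t + 1)) 1 := by
  have hN := le_totalSize hn t
  have ht' : (1 : ℝ) ≤ t := by exact_mod_cast ht
  have hC1 : (1 : ℝ) ≤ C := by exact_mod_cast (hn 1 le_rfl).trans (hC 1 le_rfl)
  have hN' : (totalSize n t : ℝ) ≤ t * C := by exact_mod_cast totalSize_le hC t
  refine le_trans ?_ (newCycleProb_one_ge hθ (ht.trans hN) (hn (t + 1) (by omega))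
    (hC _ (by omega)))
  -- The constant is due to `N_t + C ≤ tC + C ≤ 2Ct` for `t ≥ 1`.
  rw [mul_div_assoc, div_div]
  refine mul_le_mul_of_nonneg_left ?_ (newCycleProb_nonneg hθ _ _ _)
  refine div_le_div_of_nonneg_left hθ.le (by positivity) ?_
  nlinarith

theorem IsCRP.exists_le_variance_increment (hX : IsCRP P θ n X) (hθ : 0 < θ) {C : ℕ}
    (hn : ∀ i ≥ 1, 1 ≤ n i) (hC : ∀ i ≥ 1, n i ≤ C) :
    ∃ c > 0, ∀ t ≥ 1,
      c / t ≤ ∫ ω, (((X (t + 1) ω).numCycles : ℝ) - (X t ω).numCycles) ∂P ∧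
      c / t ≤ variance (fun ω => ((X (t + 1) ω).numCycles : ℝ) - (X t ω).numCycles) P := by
  have hC1 : (1 : ℝ) ≤ C := by exact_mod_cast (hn 1 le_rfl).trans (hC 1 le_rfl)
  set b : ℝ := (∑ k ∈ Finset.range (C + 1), (θ * C) ^ k)⁻¹ with hb
  have hb0 : 0 < b := by
    rw [hb]
    exact inv_pos.2 (Finset.sum_pos (fun k _ => by positivity) ⟨0, by simp⟩)
  -- A lower bound for `p_0 p_1`, which is at most the variance, and also at most `p_1`, hence at
  -- most the mean.
  refine ⟨b * (b * (θ / (2 * C))), by positivity, fun t ht => ?_⟩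
  have ht' : (1 : ℝ) ≤ t := by exact_mod_cast ht
  have hN := le_totalSize hn t
  have hm : 1 ≤ n (t + 1) := hn _ (by omega)
  have hp0 : b ≤ newCycleProb θ (totalSize n t) (n (t + 1)) 0 :=
    newCycleProb_zero_ge hθ (ht.trans hN) (hC _ (by omega))
  have hp1 : b * (θ / (2 * C)) / t ≤ newCycleProb θ (totalSize n t) (n (t + 1)) 1 :=
    le_trans (by gcongr) (newCycleProb_one_ge_div hθ hn hC ht)
  have hprod : b * (b * (θ / (2 * C))) / t ≤ newCycleProb θ (totalSize n t) (n (t + 1)) 0 *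
      newCycleProb θ (totalSize n t) (n (t + 1)) 1 := by
    rw [mul_div_assoc]
    exact mul_le_mul hp0 hp1 (by positivity) (newCycleProb_nonneg hθ _ _ _)
  have hle1 : newCycleProb θ (totalSize n t) (n (t + 1)) 0 ≤ 1 :=
    newCycleProb_zero_le_one hθ _ _
  constructor
  · rw [hX.integral_increment hθ]
    refine le_trans (hprod.trans ?_) (newCycleProb_one_le_sum hθ _ hm)
    exact mul_le_of_le_one_left (newCycleProb_nonneg hθ _ _ _) hle1
  · rw [variance_eq_integral (hX.measurable_increment t).aemeasurable]
    set μ := ∫ ω, (((X (t + 1) ω).numCycles : ℝ) - (X t ω).numCycles) ∂P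
    rw [hX.integral_comp_increment hθ t (f := fun x => (x - μ) ^ 2) (by fun_prop)]
    exact hprod.trans (le_sum_sq_sub_mul_newCycleProb hθ _ hm μ)

theorem IsCRP.variance_increment (hX : IsCRP P θ n X) (hθ : 0 < θ) {C : ℕ}
    (hC : ∀ i ≥ 1, n i ≤ C) (t : ℕ) :
    variance (fun ω => ((X (t + 1) ω).numCycles : ℝ) - (X t ω).numCycles) P =
      ∑ k ∈ Finset.range (n (t + 1) + 1),
        newCycleProb θ (totalSize n t) (n (t + 1)) k * (k * (k - 1)) +
      ∫ ω, (((X (t + 1) ω).numCycles : ℝ) - (X t ω).numCycles) ∂P -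
      (∫ ω, (((X (t + 1) ω).numCycles : ℝ) - (X t ω).numCycles) ∂P) ^ 2 := by
  rw [variance_eq_sub ((hX.hasIndepIncrements hθ hC).memLp t)]
  congr 1
  have h := hX.integral_comp_increment hθ t (f := fun x => x ^ 2) (by fun_prop)
  simp only [Pi.pow_apply]
  rw [h, hX.integral_increment hθ, ← Finset.sum_add_distrib]
  exact Finset.sum_congr rfl fun k _ => by ring

/-- Here `p_1 (tm + m - 1) = p_0 m` and `p_0 → 1`, so `t p_1 → 1` with `m` cancelling. Values `k ≥
2` contribute `O(1/t²)` to the mean. -/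
theorem IsCRP.tendsto_mul_integral_increment (hX : IsCRP P 1 n X) {m : ℕ}
    (hm : 1 ≤ m) (hn : ∀ i ≥ 1, n i = m) :
    Tendsto (fun t : ℕ =>
      t * ∫ ω, (((X (t + 1) ω).numCycles : ℝ) - (X t ω).numCycles) ∂P) atTop (𝓝 1) ∧
    Tendsto (fun t : ℕ =>
      t * variance (fun ω => ((X (t + 1) ω).numCycles : ℝ) - (X t ω).numCycles) P)
      atTop (𝓝 1) := by
  have hn1 : ∀ i ≥ 1, 1 ≤ n i := fun i hi => by rw [hn i hi]; exact hm
  have hC : ∀ i ≥ 1, n i ≤ m := fun i hi => (hn i hi).le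
  have hm' : (1 : ℝ) ≤ m := by exact_mod_cast hm
  set e : ℕ → ℝ := fun t => ∫ ω, (((X (t + 1) ω).numCycles : ℝ) - (X t ω).numCycles) ∂P with he
  set q : ℕ → ℝ := fun t => ∑ k ∈ Finset.range (n (t + 1) + 1),
    newCycleProb 1 (totalSize n t) (n (t + 1)) k * (k * (k - 1)) with hq
  have hesum : ∀ t, e t = _ := fun t => hX.integral_increment one_pos t
  have hsize : ∀ t, totalSize n t = t * m := fun t => by
    rw [totalSize, Finset.sum_congr rfl fun i hi => hn i (Finset.mem_Icc.1 hi).1]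
    simp
  have heA : ∀ t : ℕ, 1 ≤ t → e t ≤ m * (1 * m) / t := fun t ht =>
    hX.integral_increment_le one_pos hn1 hC ht
  have he0 : ∀ t, 0 ≤ e t := (hX.hasIndepIncrements one_pos hC).integral_nonneg
  have hq0 : ∀ t, 0 ≤ q t := fun t => Finset.sum_nonneg fun k _ => by
    refine mul_nonneg (newCycleProb_nonneg one_pos _ _ _) ?_
    obtain rfl | hk := Nat.eq_zero_or_pos k
    · simp
    · have : (1 : ℝ) ≤ k := by exact_mod_cast hk
      nlinarith
  have hqB : ∀ t : ℕ, 1 ≤ t → t * q t ≤ (m : ℝ) ^ 4 / t := by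
    intro t ht
    have ht' : (1 : ℝ) ≤ t := by exact_mod_cast ht
    have hN : (t : ℝ) ≤ totalSize n t := by exact_mod_cast le_totalSize hn1 t
    have h := sum_mul_sub_one_newCycleProb_le one_pos (ht.trans (le_totalSize hn1 t))
      (hC (t + 1) (by omega))
    calc _ ≤ t * ((m : ℝ) ^ 2 * (1 * m / totalSize n t) ^ 2) := by gcongr
      _ ≤ t * ((m : ℝ) ^ 2 * (1 * m / t) ^ 2) := by gcongr
      _ = _ := by field_simp
  have hinv : ∀ a : ℝ, Tendsto (fun t : ℕ => a / (t : ℝ)) atTop (𝓝 0) := fun a =>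
    tendsto_const_nhds.div_atTop tendsto_natCast_atTop_atTop
  have hqlim : Tendsto (fun t : ℕ => t * q t) atTop (𝓝 0) := by
    refine squeeze_zero' (Eventually.of_forall fun t => mul_nonneg (Nat.cast_nonneg t) (hq0 t)) ?_
      (hinv ((m : ℝ) ^ 4))
    filter_upwards [eventually_ge_atTop 1] with t ht using hqB t ht
  have helim0 : Tendsto e atTop (𝓝 0) := by
    refine squeeze_zero' (Eventually.of_forall he0) ?_ (hinv (m * (1 * m)))
    filter_upwards [eventually_ge_atTop 1] with t ht using heA t ht
  have hp1 : ∀ t : ℕ, 1 ≤ t → newCycleProb 1 (totalSize n t) (n (t + 1)) 1 * (t * m + (m - 1)) =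
      newCycleProb 1 (totalSize n t) (n (t + 1)) 0 * m := by
    intro t ht
    have h := newCycleProb_succ_mul 1 (ht.trans (le_totalSize hn1 t)) 0 (m - 1)
      (by rw [hn (t + 1) (by omega)]; omega : n (t + 1) = 0 + 1 + (m - 1))
    rw [Nat.cast_sub hm] at h
    simp only [hsize, zero_add, Nat.cast_one, sub_add_cancel, one_mul, Nat.cast_mul] at h ⊢
    exact h
  have helim : Tendsto (fun t : ℕ => t * e t) atTop (𝓝 1) := by
    -- The lower bound combines `1 - e t ≤ p_0 ≤ (t+1) p_1` with `p_1 ≤ e t`; the upper one combines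
    -- `t p_1 ≤ 1` with `e t - p_1 ≤ q t`.
    have hlow : Tendsto (fun t : ℕ => (1 - e t) * ((t : ℝ) / (t + 1))) atTop (𝓝 1) := by
      simpa using (helim0.const_sub 1).mul (tendsto_natCast_div_add_atTop (1 : ℝ))
    have hup : Tendsto (fun t : ℕ => 1 + t * q t) atTop (𝓝 1) := by
      simpa using hqlim.const_add 1
    refine tendsto_of_tendsto_of_tendsto_of_le_of_le' hlow hup ?_ ?_
    · filter_upwards [eventually_ge_atTop 1] with t ht
      have ht' : (1 : ℝ) ≤ t := by exact_mod_cast ht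
      have h0 := one_sub_sum_le_newCycleProb_zero one_pos (totalSize n t) (n (t + 1))
      have h1 := newCycleProb_one_le_sum one_pos (totalSize n t) (hn1 (t + 1) (by omega))
      rw [← hesum] at h0 h1
      have h2 := hp1 t ht
      have hpos := newCycleProb_nonneg one_pos (totalSize n t) (n (t + 1)) 1
      set p0 := newCycleProb 1 (totalSize n t) (n (t + 1)) 0
      set p1 := newCycleProb 1 (totalSize n t) (n (t + 1)) 1
      have h3 : p0 ≤ p1 * (t + 1) := by
        have : p0 * m ≤ p1 * (t + 1) * m := by
          rw [← h2, mul_assoc]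
          exact mul_le_mul_of_nonneg_left (by linarith) hpos
        exact le_of_mul_le_mul_right this (by linarith)
      rw [mul_div_assoc', div_le_iff₀ (by linarith)]
      calc _ ≤ p1 * (t + 1) * t := by gcongr; exact h0.trans h3
        _ ≤ e t * (t + 1) * t := by gcongr
        _ = _ := by ring
    · filter_upwards [eventually_ge_atTop 1] with t ht
      have ht' : (1 : ℝ) ≤ t := by exact_mod_cast ht
      have h1 := sum_sub_newCycleProb_one_le one_pos (totalSize n t) (hn1 (t + 1) (by omega))
      rw [← hesum] at h1
      have h2 := hp1 t ht
      have hle1 : newCycleProb 1 (totalSize n t) (n (t + 1)) 0 ≤ 1 :=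
        newCycleProb_zero_le_one one_pos _ _
      have hpos := newCycleProb_nonneg one_pos (totalSize n t) (n (t + 1)) 1
      set p0 := newCycleProb 1 (totalSize n t) (n (t + 1)) 0
      set p1 := newCycleProb 1 (totalSize n t) (n (t + 1)) 1
      have h3 : t * p1 ≤ 1 := by
        have : t * p1 * m ≤ 1 * m := by
          calc t * p1 * m ≤ p1 * (t * m + (m - 1)) := by nlinarith
            _ = p0 * m := h2
            _ ≤ _ := by gcongr
        exact le_of_mul_le_mul_right this (by linarith)
      have h4 : t * (e t - p1) ≤ t * q t := mul_le_mul_of_nonneg_left h1 (by linarith)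
      linarith
  refine ⟨helim, ?_⟩
  -- From `Var D = E D(D-1) + E D - (E D)²`: after multiplication by `t`, only the middle term
  -- survives.
  have h := (hqlim.add helim).sub (helim0.mul helim)
  rw [zero_add, zero_mul, sub_zero] at h
  refine h.congr fun t => ?_
  rw [hX.variance_increment one_pos hC]
  simp only [he, hq]
  ring

end Increments

end MultisetCRP

theorem theorem3 {Ω : Type*} [MeasurableSpace Ω] (P : Measure Ω) [IsProbabilityMeasure P]
    (θ : ℝ) (hθ : 0 < θ) (n : ℕ → ℕ) (hn : ∀ i ≥ 1, 1 ≤ n i) (hbdd : ∃ C : ℕ, ∀ i ≥ 1, n i ≤ C)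
    (X : (t : ℕ) → Ω → MultisetCRP.MultisetPerm n t) (hX : MultisetCRP.IsCRP P θ n X)
    (K : ℕ → Ω → ℝ) (hK : ∀ t ω, K t ω = ((X t ω).numCycles : ℝ)) :
    (θ = 1 → (∃ m : ℕ, ∀ i ≥ 1, n i = m) →
      Tendsto (fun t : ℕ => (∫ ω, K t ω ∂P) / Real.log t) atTop (𝓝 1) ∧
      Tendsto (fun t : ℕ => variance (K t) P / Real.log t) atTop (𝓝 1)) ∧
    MultisetCRP.SameOrder (fun t => ∫ ω, K t ω ∂P) (fun t => Real.log t) ∧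
    MultisetCRP.SameOrder (fun t => variance (K t) P) (fun t => Real.log t) ∧
    (∀ᵐ ω ∂P, Tendsto (fun t : ℕ => K t ω / ∫ ω', K t ω' ∂P) atTop (𝓝 1)) ∧
    TendstoInDistribution
      (fun (t : ℕ) (ω : Ω) => (K t ω - ∫ ω', K t ω' ∂P) / Real.sqrt (variance (K t) P))
      atTop (id : ℝ → ℝ) (fun _ => P) (gaussianReal 0 1) := by
  obtain ⟨C, hC⟩ := hbdd
  obtain rfl : K = fun t ω => ((X t ω).numCycles : ℝ) := funext fun t => funext (hK t)
  have h := hX.hasIndepIncrements hθ hC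
  have hC1 : (1 : ℝ) ≤ C := by exact_mod_cast (hn 1 le_rfl).trans (hC 1 le_rfl)
  obtain ⟨c, hc, hlow⟩ := hX.exists_le_variance_increment hθ hn hC
  have hup := fun t ht => hX.integral_increment_le hθ hn hC (t := t) ht
  have hE : MultisetCRP.SameOrder (fun t => ∫ ω, ((X t ω).numCycles : ℝ) ∂P)
      (fun t => Real.log t) := by
    simp_rw [h.integral_eq_sum]
    exact MultisetCRP.sameOrder_sum_log hc (by positivity) (h.integral_nonneg 0)
      (fun i hi => (hlow i hi).1) hup
  have hV : MultisetCRP.SameOrder (fun t => variance (fun ω => ((X t ω).numCycles : ℝ)) P)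
      (fun t => Real.log t) := by
    simp_rw [h.variance_eq_sum]
    refine MultisetCRP.sameOrder_sum_log (A := C * (C * (θ * C))) hc (by positivity)
      (variance_nonneg _ _) (fun i hi => (hlow i hi).2) fun i hi => ?_
    refine (h.variance_le i).trans ?_
    rw [mul_div_assoc]
    exact mul_le_mul_of_nonneg_left (hup i hi) (by linarith)
  refine ⟨?_, hE, hV, h.ae_tendsto_div_integral hE.tendsto_atTop,
    h.tendstoInDistribution hV.tendsto_atTop⟩
  rintro rfl ⟨m, hm⟩
  have hlim := hX.tendsto_mul_integral_increment (hm 1 le_rfl ▸ hn 1 le_rfl) hm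
  constructor
  · simp_rw [h.integral_eq_sum]
    exact MultisetCRP.tendsto_sum_range_div_log hlim.1
  · simp_rw [h.variance_eq_sum]
    exact MultisetCRP.tendsto_sum_range_div_log hlim.2
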